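/- Let $Y\subset\mathbb R^d$ and $U\subset\mathbb R^l$ be bounded open sets with Lebesgue measure, let $T>0$, and let $\sigma:\mathbb R\to\mathbb R$ be Lipschitz continuous and $C^1$ with $\sigma'>0$ on $\mathbb R$. Let $A\subset\mathbb R^2$ be bounded, closed and convex with non-empty interior, and set $$\mathscr C=\{(a,b)\in L^\infty(Y\times(0,T))\times L^\infty(Y\times Y\times(0,T)):\ (a(y,t),b(y,z,t))\in A\ \text{for a.e. } (y,z,t)\},$$ $$\mathscr A=\{(\alpha,\beta)\in\mathbb R\times L^\infty(Y):\ (\alpha,\beta(z))\in A\ \text{for a.e. } z\in Y\},$$ with interiors and boundaries taken in the norm topologies of $L^\infty\times L^\infty$ and of $\mathbb R\times L^\infty(Y)$. Let $w\in L^2(U\times Y)$, $\mu\in L^2(U)$, $P^{(1)},\dots,P^{(N)}\in L^2(U)$, and let $f_I^{(1)},\dots,f_I^{(N)}\in L^2(Y)$ be weakly linearly independent, i.e. $\sum_j\lambda_j=0$ and $\sum_j\lambda_jf^{(j)}_I=0$ a.e. imply $\lambda_1=\dots=\lambda_N=0$. For $(a,b)\in\mathscr C$ let $f^{(j)}\in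 C([0,T];L^2(Y))$ be the solution of $$\partial_tf^{(j)}(y,t)=\sigma\big(\xi^{(j)}(y,t)\big),\qquad f^{(j)}(\cdot,0)=f_I^{(j)},\qquad \xi^{(j)}(y,t)=a(y,t)-\int_Yb(y,z,t)f^{(j)}(z,t)\,dz .$$ Set $Z^{(j)}=Wf^{(j)}(\cdot,T)+\mu$ with $(W\varphi)(u)=\int_Yw(u,y)\varphi(y)\,dy$, and, in the regression case $h(\xi)=\xi$, let $J(a,b)=\frac1{2N}\sum_{j=1}^N\int_U|Z^{(j)}-P^{(j)}|^2\,du$. Let $(\bar a,\bar b)\in\mathscr C$ minimize $J$ over $\mathscr C$, with trajectories $\bar f^{(j)}$, outputs $\bar Z^{(j)}$ and preactivations $\bar\xi^{(j)}$. Then the following hold. (i) Either $(\bar a,\bar b)$ is in the interior of $\mathscr C$ and for every $j$ the terminal state $\bar f^{(j)}(\cdot,T)$ is a least-squares solution of "$Wf=P^{(j)}-\mu$" (that is, $W^*W\bar f^{(j)}(\cdot,T)=W^*(P^{(j)}-\mu)$, equivalently $\bar f^{(j)}(\cdot,T)$ minimizes $\|W\varphi+\mu-P^{(j)}\|_{L^2(U)}$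 over $\varphi\in L^2(Y)$), or $(\bar a,\bar b)\in\partial\mathscr C$. (ii) The co-state problem $$\partial_tr^{(j)}(y,t)=\int_Y\bar b(z,y,t)\,\sigma'\big(\bar\xi^{(j)}(z,t)\big)\,r^{(j)}(z,t)\,dz,\qquad r^{(j)}(y,T)=\int_U\big(\bar Z^{(j)}(u)-P^{(j)}(u)\big)w(u,y)\,du$$ has a solution $r=(r^{(1)},\dots,r^{(N)})\in C([0,T];L^2(Y))^N$, and there is $\varepsilon\in(0,T]$ such that for a.e. $t\in(0,\varepsilon)$ and a.e. $y\in Y$ with $r(y,t)\neq0$ one has $(\bar a(y,t),\bar b(y,\cdot,t))\in\partial\mathscr A$. -/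

import Mathlib

open MeasureTheory Set
open scoped ENNReal

noncomputable section

/-! ### Spaces and measures -/

/-- Lebesgue measure on a subset of Euclidean space. -/
abbrev domMeasure {d : ℕ} (Y : Set (EuclideanSpace ℝ (Fin d))) :
    Measure (EuclideanSpace ℝ (Fin d)) :=
  volume.restrict Y

/-- Lebesgue measure on the time interval `(0, T)`. -/
abbrev timeMeasure (T : ℝ) : Measure ℝ := volume.restrict (Ioo 0 T)

/-- `L²(Y)`. -/
abbrev StateSpace {d : ℕ} (Y : Set (EuclideanSpace ℝ (Fin d))) : Type :=
  Lp ℝ 2 (domMeasure Y)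

/-- Biases `a = a(y, t)`: the space `L^∞(Y × (0, T))`. -/
abbrev BiasSpace {d : ℕ} (Y : Set (EuclideanSpace ℝ (Fin d))) (T : ℝ) : Type :=
  Lp ℝ ∞ ((domMeasure Y).prod (timeMeasure T))

/-- Weights `b = b(y, z, t)`, read as `b ((y, z), t)`: the space `L^∞(Y × Y × (0, T))`. -/
abbrev WeightSpace {d : ℕ} (Y : Set (EuclideanSpace ℝ (Fin d))) (T : ℝ) : Type :=
  Lp ℝ ∞ (((domMeasure Y).prod (domMeasure Y)).prod (timeMeasure T))

/-- Output weights `w = w(u, y)`: the space `L²(U × Y)`. -/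
abbrev OutputWeightSpace {l d : ℕ} (U : Set (EuclideanSpace ℝ (Fin l)))
    (Y : Set (EuclideanSpace ℝ (Fin d))) : Type :=
  Lp ℝ 2 ((domMeasure U).prod (domMeasure Y))

/-! ### Control sets -/

/-- The set of controls `(a, b) ∈ L^∞ × L^∞` with `(a(y,t), b(y,z,t)) ∈ A` for almost every
`(y, z, t)`. Its interior and boundary are those of the norm topology of `L^∞ × L^∞`. -/
def controlSet {d : ℕ} (Y : Set (EuclideanSpace ℝ (Fin d))) (T : ℝ) (A : Set (ℝ × ℝ)) :
    Set (BiasSpace Y T × WeightSpace Y T) :=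
  {c | ∀ᵐ p ∂(((domMeasure Y).prod (domMeasure Y)).prod (timeMeasure T)),
    (c.1 (p.1.1, p.2), c.2 p) ∈ A}

/-- The set of `(α, β) ∈ ℝ × L^∞(Y)` with `(α, β(z)) ∈ A` for almost every `z`. Its boundary is
that of the norm topology of `ℝ × L^∞(Y)`. -/
def localControlSet {d : ℕ} (Y : Set (EuclideanSpace ℝ (Fin d))) (A : Set (ℝ × ℝ)) :
    Set (ℝ × Lp ℝ ∞ (domMeasure Y)) :=
  {c | ∀ᵐ z ∂(domMeasure Y), (c.1, c.2 z) ∈ A}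

/-! ### Weak linear independence -/

/-- The only linear relation with coefficients of sum zero is the trivial one. -/
def WeaklyLinearIndependent {N : ℕ} {V : Type*} [AddCommGroup V] [Module ℝ V]
    (φ : Fin N → V) : Prop :=
  ∀ c : Fin N → ℝ, ∑ j, c j = 0 → ∑ j, c j • φ j = 0 → ∀ j, c j = 0

/-! ### Forward problem -/

/-- `ξ(y, s) = a(y, s) - ∫_Y b(y, z, s) f(z) dz`, the argument of the activation function at
time `s` in the state `f`. -/
def preactivation {d : ℕ} {Y : Set (EuclideanSpace ℝ (Fin d))} {T : ℝ}
    (c : BiasSpace Y T × WeightSpace Y T) (f : StateSpace Y)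
    (y : EuclideanSpace ℝ (Fin d)) (s : ℝ) : ℝ :=
  c.1 (y, s) - ∫ z in Y, c.2 ((y, z), s) * f z

/-- `f ∈ C([0, T]; L²(Y))` solves `∂ₜ f = σ(a - B_b f)`, `f(0) = f_I`, in integrated form. Only the
values of `f` on `[0, T]` matter. -/
def IsForwardSolution {d : ℕ} {Y : Set (EuclideanSpace ℝ (Fin d))} {T : ℝ} (σ : ℝ → ℝ)
    (c : BiasSpace Y T × WeightSpace Y T) (fI : StateSpace Y) (f : ℝ → StateSpace Y) : Prop :=
  ContinuousOn f (Icc 0 T) ∧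
    ∀ t ∈ Icc 0 T, ∀ᵐ y ∂(domMeasure Y),
      f t y = fI y + ∫ s in (0 : ℝ)..t, σ (preactivation c (f s) y s)

/-! ### Output layer and loss -/

/-- `Z(u) = ∫_Y w(u, y) f(y) dy + μ(u)`. -/
def networkOutput {l d : ℕ} {U : Set (EuclideanSpace ℝ (Fin l))}
    {Y : Set (EuclideanSpace ℝ (Fin d))} (w : OutputWeightSpace U Y) (μ : StateSpace U)
    (f : StateSpace Y) (u : EuclideanSpace ℝ (Fin l)) : ℝ :=
  (∫ y in Y, w (u, y) * f y) + μ u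

/-- The mean square loss `(1 / 2N) ∑ⱼ ∫_U |h(Z⁽ʲ⁾(u)) - P⁽ʲ⁾(u)|² du` of terminal states
`f⁽¹⁾, …, f⁽ᴺ⁾`. -/
def mseLoss {l d N : ℕ} {U : Set (EuclideanSpace ℝ (Fin l))}
    {Y : Set (EuclideanSpace ℝ (Fin d))} (h : ℝ → ℝ) (w : OutputWeightSpace U Y)
    (μ : StateSpace U) (P : Fin N → StateSpace U) (f : Fin N → StateSpace Y) : ℝ :=
  1 / (2 * (N : ℝ)) * ∑ j, ∫ u in U, |h (networkOutput w μ (f j) u) - P j u| ^ 2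

/-- `c = (a, b)` is an optimal control with trajectory `F = (f⁽¹⁾, …, f⁽ᴺ⁾)`: it lies in the control
set and its loss is minimal among all controls of that set. -/
def IsOptimalControl {l d N : ℕ} {U : Set (EuclideanSpace ℝ (Fin l))}
    {Y : Set (EuclideanSpace ℝ (Fin d))} {T : ℝ} (σ h : ℝ → ℝ) (A : Set (ℝ × ℝ))
    (w : OutputWeightSpace U Y) (μ : StateSpace U) (P : Fin N → StateSpace U)
    (fI : Fin N → StateSpace Y) (c : BiasSpace Y T × WeightSpace Y T)
    (F : Fin N → ℝ → StateSpace Y) : Prop :=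
  c ∈ controlSet Y T A ∧ (∀ j, IsForwardSolution σ c (fI j) (F j)) ∧
    ∀ c' ∈ controlSet Y T A, ∀ F' : Fin N → ℝ → StateSpace Y,
      (∀ j, IsForwardSolution σ c' (fI j) (F' j)) →
        mseLoss h w μ P (fun j => F j T) ≤ mseLoss h w μ P (fun j => F' j T)

/-! ### Backward problem -/

/-- `r ∈ C([0, T]; L²(Y))` is the co-state of one datum with label `P` along the trajectory `f`:
it solves `∂ₜ r(y, t) = ∫_Y b(z, y, t) σ'(ξ(z, t)) r(z, t) dz` (in integrated form) with terminal
value `r(y, T) = ∫_U (h(Z(u)) - P(u)) h'(Z(u)) w(u, y) du`. -/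
def IsCostate {l d : ℕ} {U : Set (EuclideanSpace ℝ (Fin l))}
    {Y : Set (EuclideanSpace ℝ (Fin d))} {T : ℝ} (σ h : ℝ → ℝ)
    (w : OutputWeightSpace U Y) (μ P : StateSpace U)
    (c : BiasSpace Y T × WeightSpace Y T) (f r : ℝ → StateSpace Y) : Prop :=
  ContinuousOn r (Icc 0 T) ∧
    ∀ t ∈ Icc 0 T, ∀ᵐ y ∂(domMeasure Y),
      r t y =
        (∫ u in U, (h (networkOutput w μ (f T) u) - P u) *
            deriv h (networkOutput w μ (f T) u) * w (u, y)) -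
          ∫ s in t..T, ∫ z in Y,
            c.2 ((z, y), s) * (deriv σ (preactivation c (f s) z s) * r s z)

/-! ### Least-squares solutions -/

/-- `f` is a least-squares solution of `W f = P - μ`, where `(W φ)(u) = ∫_Y w(u, y) φ(y) dy`: it
satisfies the normal equation `W* (W f + μ - P) = 0` and minimizes `φ ↦ ‖W φ + μ - P‖` over `L²(Y)`
(either property implies the other). -/
def IsLeastSquaresSolution {l d : ℕ} {U : Set (EuclideanSpace ℝ (Fin l))}
    {Y : Set (EuclideanSpace ℝ (Fin d))} (w : OutputWeightSpace U Y) (μ P : StateSpace U)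
    (f : StateSpace Y) : Prop :=
  (∀ᵐ y ∂(domMeasure Y), ∫ u in U, (networkOutput w μ f u - P u) * w (u, y) = 0) ∧
    ∀ φ : StateSpace Y,
      ∫ u in U, |networkOutput w μ f u - P u| ^ 2 ≤ ∫ u in U, |networkOutput w μ φ u - P u| ^ 2

end

/-!
An optimal control is perturbed only where it stays away from the boundary of `A`; there the first
variation of the loss has to vanish, which for small times annihilates the co-states.

*Reduction to bounded preactivations.* Fix representatives of `(a, b)` that are bounded and
measurable everywhere. Eliminating the state from `ξ = a - ∫ b f`, `∂ₜ f = σ(ξ)` leaves a Volterra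
equation for the preactivation `ξ` on `Y × (0, T)` with a bounded kernel (`IsPreactivation`). It is
solved by Picard iteration in a supremum norm with exponential weight
(`exists_hammerstein_solution`), and the same weights give Lipschitz dependence on the control. The
co-state solves the linear equation with the transposed kernel (`IsAdjoint`); its terminal value is
the gradient `W*(W f(T) + μ - P)` of the quadratic loss.

*First-order condition.* For controls `(a + τ a', b + τ b')` the increment of `ξ` satisfies an exact
identity. Pairing it with the co-state cancels everything but `τ ∫ q (a' - ∫ b' f)`, where
`q = σ'(ξ) r`, and the Taylor remainder of `σ`, which is `o(τ)`
(`IsAdjoint.exists_abs_variation_sub_le`). Hence `∑ⱼ ∫ qⱼ (a' - ∫ b' fⱼ) ≥ 0` for every admissible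
direction (`IsOptimalControl.sum_integral_nonneg`).

*Localization.* On the set where `(a, b)` keeps the distance `δ` from the boundary of `A`, truncations
of `-∑ⱼ qⱼ` and of `∑ⱼ qⱼ fⱼ` form an admissible direction, so both sums vanish there
(`IsOptimalControl.moments_eq_zero`). Weak linear independence is linear independence of the vectors
`(1, fⱼ)`, an open condition, so it persists from the initial data to the states at small times; there
the two relations force `qⱼ = 0`, and `rⱼ = 0` because `σ' > 0`. This is the second assertion.

*Interior controls.* If the control is an interior point, this applies at almost every point, so the
co-states vanish for small times. The co-state equation is linear and can also be solved forwards in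
time, hence the terminal value vanishes as well
(`IsAdjoint.terminal_eq_zero_of_initial_eq_zero`). This is the normal equation, which by convexity
characterizes least-squares solutions.
-/

/-! ### Bounded measurable functions -/

/-- A real function that is measurable and bounded, everywhere and not only almost everywhere. -/
structure BddMeas {α : Type*} [MeasurableSpace α] (h : α → ℝ) : Prop where
  meas : Measurable h
  bdd : ∃ C, ∀ x, |h x| ≤ C

namespace BddMeas

variable {α β : Type*} [MeasurableSpace α] [MeasurableSpace β] {g h : α → ℝ}

theorem exists_pos (hh : BddMeas h) : ∃ C, 0 < C ∧ ∀ x, |h x| ≤ C := by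
  obtain ⟨C, hC⟩ := hh.bdd
  exact ⟨max C 1, by positivity, fun x => (hC x).trans (le_max_left _ _)⟩

theorem const (c : ℝ) : BddMeas (fun _ : α => c) := ⟨measurable_const, |c|, fun _ => le_rfl⟩

theorem add (hg : BddMeas g) (hh : BddMeas h) : BddMeas (fun x => g x + h x) := by
  obtain ⟨C, hC⟩ := hg.bdd
  obtain ⟨D, hD⟩ := hh.bdd
  exact ⟨hg.meas.add hh.meas, C + D, fun x => (abs_add_le _ _).trans (add_le_add (hC x) (hD x))⟩

theorem mul (hg : BddMeas g) (hh : BddMeas h) : BddMeas (fun x => g x * h x) := by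
  obtain ⟨C, hC⟩ := hg.bdd
  obtain ⟨D, hD⟩ := hh.bdd
  refine ⟨hg.meas.mul hh.meas, C * D, fun x => ?_⟩
  rw [abs_mul]
  exact mul_le_mul (hC x) (hD x) (abs_nonneg _) ((abs_nonneg _).trans (hC x))

theorem const_mul (hh : BddMeas h) (c : ℝ) : BddMeas (fun x => c * h x) := (const c).mul hh

theorem neg (hh : BddMeas h) : BddMeas (fun x => -h x) := by
  simpa using hh.const_mul (-1)

theorem sub (hg : BddMeas g) (hh : BddMeas h) : BddMeas (fun x => g x - h x) := by
  simpa [sub_eq_add_neg] using hg.add hh.neg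

theorem comp (hh : BddMeas h) {e : β → α} (he : Measurable e) : BddMeas (fun x => h (e x)) := by
  obtain ⟨C, hC⟩ := hh.bdd
  exact ⟨hh.meas.comp he, C, fun x => hC _⟩

theorem continuous_comp (hh : BddMeas h) {σ : ℝ → ℝ} (hσ : Continuous σ) :
    BddMeas (fun x => σ (h x)) := by
  obtain ⟨C, hC⟩ := hh.bdd
  obtain ⟨D, hD⟩ := (isCompact_Icc (a := -C) (b := C)).exists_bound_of_continuousOn hσ.continuousOn
  exact ⟨hσ.measurable.comp hh.meas, D, fun x => by simpa using hD _ (abs_le.1 (hC x))⟩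

theorem ite {p : α → Prop} [DecidablePred p] (hp : MeasurableSet {x | p x}) (hg : BddMeas g)
    (hh : BddMeas h) : BddMeas (fun x => if p x then g x else h x) := by
  obtain ⟨C, hC⟩ := hg.bdd
  obtain ⟨D, hD⟩ := hh.bdd
  refine ⟨Measurable.ite hp hg.meas hh.meas, max C D, fun x => ?_⟩
  split_ifs
  · exact (hC x).trans (le_max_left _ _)
  · exact (hD x).trans (le_max_right _ _)

theorem integrable (hh : BddMeas h) {ν : Measure α} [IsFiniteMeasure ν] : Integrable h ν := by
  obtain ⟨C, hC⟩ := hh.bdd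
  exact Integrable.of_bound hh.meas.aestronglyMeasurable C (by simpa using Filter.Eventually.of_forall hC)

theorem memLp (hh : BddMeas h) {ν : Measure α} [IsFiniteMeasure ν] (p : ℝ≥0∞) : MemLp h p ν := by
  obtain ⟨C, hC⟩ := hh.bdd
  exact MemLp.of_bound hh.meas.aestronglyMeasurable C (by simpa using Filter.Eventually.of_forall hC)

theorem mul_integrable (hh : BddMeas h) {ν : Measure α} (hg : Integrable g ν) :
    Integrable (fun x => h x * g x) ν := by
  obtain ⟨C, hC⟩ := hh.bdd
  exact hg.bdd_mul (c := C) hh.meas.aestronglyMeasurable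
    (by simpa using Filter.Eventually.of_forall hC)

theorem integral_mul {k : α × β → ℝ} (hk : BddMeas k) {ν : Measure β} [SFinite ν] {u : β → ℝ}
    (hu : Measurable u) (hui : Integrable u ν) : BddMeas (fun x => ∫ y, k (x, y) * u y ∂ν) := by
  obtain ⟨C, hC0, hC⟩ := hk.exists_pos
  refine ⟨?_, C * ∫ y, |u y| ∂ν, fun x => ?_⟩
  · exact ((hk.meas.mul (hu.comp measurable_snd)).stronglyMeasurable.integral_prod_right).measurable
  · rw [← integral_const_mul, ← Real.norm_eq_abs]
    refine norm_integral_le_of_norm_le (hui.abs.const_mul C) (Filter.Eventually.of_forall fun y => ?_)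
    rw [Real.norm_eq_abs, abs_mul]
    exact mul_le_mul_of_nonneg_right (hC _) (abs_nonneg _)

theorem integral_right {k : α × β → ℝ} (hk : BddMeas k) {ν : Measure β} [IsFiniteMeasure ν] :
    BddMeas (fun x => ∫ y, k (x, y) ∂ν) := by
  simpa using hk.integral_mul (ν := ν) (measurable_const (a := (1 : ℝ))) (integrable_const _)

end BddMeas

/-! ### Hammerstein equations with a weighted contraction -/

/-- A bounded function whose weighted supremum norm satisfies `S ≤ S / 2 + η` has norm at most
`2 η`. -/
theorem abs_le_two_mul_of_forall_half {Ω : Type*} {D θ : Ω → ℝ} {C η : ℝ} (hθ : ∀ p, 1 ≤ θ p)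
    (hη : 0 ≤ η) (hD : ∀ p, |D p| ≤ C)
    (h : ∀ S, 0 ≤ S → (∀ p, |D p| ≤ S * θ p) → ∀ p, |D p| ≤ (S / 2 + η) * θ p) (p : Ω) :
    |D p| ≤ 2 * η * θ p := by
  have hC : 0 ≤ C := (abs_nonneg _).trans (hD p)
  have key : ∀ n : ℕ, ∀ p, |D p| ≤ (C * (1 / 2) ^ n + 2 * η) * θ p := by
    intro n
    induction n with
    | zero =>
      intro p
      have h1 := hθ p
      nlinarith [hD p, mul_nonneg hC (sub_nonneg.2 h1), mul_nonneg hη (zero_le_one.trans h1)]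
    | succ n ih =>
      intro p
      refine (h _ (by positivity) ih p).trans (le_of_eq ?_)
      ring
  have hlim : Filter.Tendsto (fun n : ℕ => (C * (1 / 2 : ℝ) ^ n + 2 * η) * θ p) Filter.atTop
      (nhds ((C * 0 + 2 * η) * θ p)) :=
    (((tendsto_pow_atTop_nhds_zero_of_lt_one (by norm_num) (by norm_num)).const_mul C).add_const
      _).mul_const _
  have := ge_of_tendsto' hlim fun n => key n p
  simpa using this

section Hammerstein

variable {Ω : Type*} [MeasurableSpace Ω] {m : Measure Ω} [IsFiniteMeasure m] {k : Ω × Ω → ℝ}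
  {θ : Ω → ℝ} {L δ : ℝ} {φ : Ω → ℝ → ℝ}

/-- In the supremum norm with weight `θ`, the operator `x ↦ ∫ k(·, q) φ(q, x(q)) dq` halves
distances. -/
theorem abs_integral_kernel_sub_le (hk : BddMeas k) (hθ : BddMeas θ) (hθ1 : ∀ p, 1 ≤ θ p)
    (hL : 0 ≤ L) (hLδ : L * δ ≤ 1 / 2) (hkθ : ∀ p, ∫ q, |k (p, q)| * θ q ∂m ≤ δ * θ p)
    (hφ : ∀ x, BddMeas x → BddMeas fun q => φ q (x q))
    (hφL : ∀ q u v, |φ q u - φ q v| ≤ L * |u - v|) {x x' : Ω → ℝ} (hx : BddMeas x)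
    (hx' : BddMeas x') {S : ℝ} (hS : 0 ≤ S) (h : ∀ q, |x q - x' q| ≤ S * θ q) (p : Ω) :
    |(∫ q, k (p, q) * φ q (x q) ∂m) - ∫ q, k (p, q) * φ q (x' q) ∂m| ≤ S / 2 * θ p := by
  have hkp : BddMeas fun q => k (p, q) := hk.comp measurable_prodMk_left
  rw [← integral_sub (hkp.mul (hφ x hx)).integrable (hkp.mul (hφ x' hx')).integrable]
  have habs : BddMeas fun q => |k (p, q)| * θ q :=
    (hkp.continuous_comp continuous_abs).mul hθ
  calc |∫ q, (k (p, q) * φ q (x q) - k (p, q) * φ q (x' q)) ∂m|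
      ≤ ∫ q, (L * S) * (|k (p, q)| * θ q) ∂m := by
        rw [← Real.norm_eq_abs]
        refine norm_integral_le_of_norm_le (habs.const_mul _).integrable
          (Filter.Eventually.of_forall fun q => ?_)
        rw [Real.norm_eq_abs, ← mul_sub, abs_mul]
        have := (hφL q (x q) (x' q)).trans (mul_le_mul_of_nonneg_left (h q) hL)
        calc |k (p, q)| * |φ q (x q) - φ q (x' q)| ≤ |k (p, q)| * (L * (S * θ q)) :=
              mul_le_mul_of_nonneg_left this (abs_nonneg _)
          _ = _ := by ring
    _ = (L * S) * ∫ q, |k (p, q)| * θ q ∂m := integral_const_mul _ _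
    _ ≤ (L * S) * (δ * θ p) := mul_le_mul_of_nonneg_left (hkθ p) (by positivity)
    _ = (L * δ) * (S * θ p) := by ring
    _ ≤ 1 / 2 * (S * θ p) :=
        mul_le_mul_of_nonneg_right hLδ (mul_nonneg hS (zero_le_one.trans (hθ1 p)))
    _ = S / 2 * θ p := by ring

/-- Picard iteration in the supremum norm with weight `θ`. -/
theorem exists_hammerstein_solution (hk : BddMeas k) (hθ : BddMeas θ) (hθ1 : ∀ p, 1 ≤ θ p)
    (hL : 0 ≤ L) (hLδ : L * δ ≤ 1 / 2) (hkθ : ∀ p, ∫ q, |k (p, q)| * θ q ∂m ≤ δ * θ p)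
    (hφ : ∀ x, BddMeas x → BddMeas fun q => φ q (x q))
    (hφL : ∀ q u v, |φ q u - φ q v| ≤ L * |u - v|) {α : Ω → ℝ} (hα : BddMeas α) :
    ∃ x, BddMeas x ∧ ∀ p, x p = α p - ∫ q, k (p, q) * φ q (x q) ∂m := by
  set Φ : (Ω → ℝ) → Ω → ℝ := fun x p => α p - ∫ q, k (p, q) * φ q (x q) ∂m with hΦdef
  have hΦ : ∀ x, BddMeas x → BddMeas (Φ x) := fun x hx =>
    hα.sub (hk.integral_mul (hφ x hx).meas (hφ x hx).integrable)
  have hcon : ∀ x x', BddMeas x → BddMeas x' → ∀ S, 0 ≤ S → (∀ q, |x q - x' q| ≤ S * θ q) →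
      ∀ p, |Φ x p - Φ x' p| ≤ S / 2 * θ p := by
    intro x x' hx hx' S hS h p
    have := abs_integral_kernel_sub_le hk hθ hθ1 hL hLδ hkθ hφ hφL hx hx' hS h p
    rw [abs_sub_comm] at this
    simpa [hΦdef] using this
  set X : ℕ → Ω → ℝ := fun n => Φ^[n] (fun _ => 0)
  have hXs : ∀ n, X (n + 1) = Φ (X n) := fun n => Function.iterate_succ_apply' _ _ _
  have hXb : ∀ n, BddMeas (X n) := by
    intro n
    induction n with
    | zero => exact BddMeas.const 0
    | succ n ih => rw [hXs]; exact hΦ _ ih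
  obtain ⟨C, hC0, hC⟩ := (hXb 1).exists_pos
  have hstep : ∀ n p, |X n p - X (n + 1) p| ≤ C / 2 ^ n * θ p := by
    intro n
    induction n with
    | zero =>
      intro p
      have h0 : X 0 p = 0 := rfl
      rw [h0, zero_sub, abs_neg]
      have h1 := hθ1 p
      have h2 := hC p
      simp only [zero_add, pow_zero, div_one]
      nlinarith
    | succ n ih =>
      intro p
      rw [hXs (n + 1)]
      nth_rewrite 1 [hXs n]
      refine (hcon _ _ (hXb n) (hXb (n + 1)) _ (by positivity) ih p).trans (le_of_eq ?_)
      rw [pow_succ]; ring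
  have hdist : ∀ p n, dist (X n p) (X (n + 1) p) ≤ (2 * C * θ p) / 2 / 2 ^ n := by
    intro p n
    rw [Real.dist_eq]
    refine (hstep n p).trans (le_of_eq ?_)
    ring
  have hlim : ∀ p, ∃ l, Filter.Tendsto (fun n => X n p) Filter.atTop (nhds l) := fun p =>
    cauchySeq_tendsto_of_complete (cauchySeq_of_le_geometric_two (hdist p))
  choose x hx using hlim
  have hxn : ∀ n p, |X n p - x p| ≤ 2 * C / 2 ^ n * θ p := by
    intro n p
    have := dist_le_of_le_geometric_two_of_tendsto (hdist p) (hx p) n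
    rw [Real.dist_eq] at this
    refine this.trans (le_of_eq ?_)
    ring
  obtain ⟨B, hB⟩ := hθ.bdd
  have hxb : BddMeas x := by
    refine ⟨measurable_of_tendsto_metrizable (fun n => (hXb n).meas) (tendsto_pi_nhds.2 hx),
      2 * C * B, fun p => ?_⟩
    have h0 : X 0 p = 0 := rfl
    have := hxn 0 p
    rw [h0, zero_sub, abs_neg, pow_zero, div_one] at this
    exact this.trans (mul_le_mul_of_nonneg_left ((le_abs_self _).trans (hB p)) (by positivity))
  refine ⟨x, hxb, fun p => ?_⟩
  have h1 : Filter.Tendsto (fun n => X (n + 1) p) Filter.atTop (nhds (x p)) :=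
    (hx p).comp (Filter.tendsto_add_atTop_nat 1)
  have h2 : Filter.Tendsto (fun n => X (n + 1) p) Filter.atTop (nhds (Φ x p)) := by
    rw [tendsto_iff_dist_tendsto_zero]
    have hz : Filter.Tendsto (fun n : ℕ => C * θ p * (1 / 2 : ℝ) ^ n) Filter.atTop (nhds 0) := by
      simpa using (tendsto_pow_atTop_nhds_zero_of_lt_one (r := (1 / 2 : ℝ)) (by norm_num)
        (by norm_num)).const_mul (C * θ p)
    refine squeeze_zero (fun _ => dist_nonneg) (fun n => ?_) hz
    rw [Real.dist_eq, hXs]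
    refine (hcon _ _ (hXb n) hxb _ (by positivity) (hxn n) p).trans (le_of_eq ?_)
    rw [one_div, inv_pow]; ring
  exact tendsto_nhds_unique h1 h2

end Hammerstein

/-! ### Kernels with memory -/

/-- The Volterra kernel of a weight `β(y, z, t)`: with `p = (y, t)` and `q = (z, s)`, it is
`β(y, z, t)` for `s < t` and `0` otherwise. -/
noncomputable def volterraKernel {E : Type*} (β : (E × E) × ℝ → ℝ) (x : (E × ℝ) × (E × ℝ)) : ℝ :=
  if x.2.2 < x.1.2 then β ((x.1.1, x.2.1), x.1.2) else 0

/-- The primitive in time, `(y, t) ↦ ∫₀ᵗ h(y, s) ds` for `t ∈ [0, T]`. -/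
noncomputable def pastIntegral {E : Type*} (T : ℝ) (h : E × ℝ → ℝ) (p : E × ℝ) : ℝ :=
  ∫ s, (if s < p.2 then h (p.1, s) else 0) ∂(timeMeasure T)

/-- The nearest point of `[0, T]` to `t`. Weights built from it are bounded for all times. -/
noncomputable def clampTime (T t : ℝ) : ℝ := min T (max 0 t)

theorem clampTime_nonneg {T : ℝ} (hT : 0 ≤ T) (t : ℝ) : 0 ≤ clampTime T t :=
  le_min hT (le_max_left _ _)

theorem clampTime_le (T t : ℝ) : clampTime T t ≤ T := min_le_left _ _

theorem clampTime_of_mem {T t : ℝ} (ht : t ∈ Icc 0 T) : clampTime T t = t := by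
  rw [clampTime, max_eq_right ht.1, min_eq_right ht.2]

theorem continuous_clampTime (T : ℝ) : Continuous (clampTime T) := by
  unfold clampTime; fun_prop

theorem integral_exp_mul_clampTime_le {T l : ℝ} (hT : 0 ≤ T) (hl : 0 < l) (t : ℝ) :
    ∫ s, (if s < t then Real.exp (l * clampTime T s) else 0) ∂(timeMeasure T) ≤
      Real.exp (l * clampTime T t) / l := by
  have h1 : ∫ s, (if s < t then Real.exp (l * clampTime T s) else 0) ∂(timeMeasure T) =
      ∫ s in Ioo 0 T, (Iio t).indicator (fun s => Real.exp (l * s)) s := by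
    refine setIntegral_congr_fun measurableSet_Ioo fun s hs => ?_
    simp only [indicator, mem_Iio, clampTime_of_mem (Ioo_subset_Icc_self hs)]
  have hc : Continuous fun s : ℝ => Real.exp (l * s) := by fun_prop
  have h2 : ∫ s in Ioo 0 T ∩ Iio t, Real.exp (l * s) ≤
      ∫ s in Ioc 0 (clampTime T t), Real.exp (l * s) := by
    refine setIntegral_mono_set (hc.integrableOn_Ioc)
      (Filter.Eventually.of_forall fun s => (Real.exp_pos _).le) (LE.le.eventuallyLE ?_)
    rintro s ⟨hs, hst⟩
    exact ⟨hs.1, le_min hs.2.le (le_max_of_le_right hst.le)⟩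
  rw [h1, setIntegral_indicator measurableSet_Iio]
  refine h2.trans ?_
  rw [← intervalIntegral.integral_of_le (clampTime_nonneg hT t), intervalIntegral.integral_comp_mul_left
    (fun x => Real.exp x) hl.ne', integral_exp, smul_eq_mul, mul_zero, Real.exp_zero, div_eq_inv_mul]
  exact mul_le_mul_of_nonneg_left (by linarith) (by positivity)

theorem integral_exp_mul_sub_clampTime_le {T l : ℝ} (hl : 0 < l) (t : ℝ) :
    ∫ s, (if t < s then Real.exp (l * (T - clampTime T s)) else 0) ∂(timeMeasure T) ≤
      Real.exp (l * (T - clampTime T t)) / l := by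
  have h1 : ∫ s, (if t < s then Real.exp (l * (T - clampTime T s)) else 0) ∂(timeMeasure T) =
      ∫ s in Ioo 0 T, (Ioi t).indicator (fun s => Real.exp (l * (T - s))) s := by
    refine setIntegral_congr_fun measurableSet_Ioo fun s hs => ?_
    simp only [indicator, mem_Ioi, clampTime_of_mem (Ioo_subset_Icc_self hs)]
  have hc : Continuous fun s : ℝ => Real.exp (l * (T - s)) := by fun_prop
  have h2 : ∫ s in Ioo 0 T ∩ Ioi t, Real.exp (l * (T - s)) ≤
      ∫ s in Ioc (clampTime T t) T, Real.exp (l * (T - s)) := by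
    refine setIntegral_mono_set (hc.integrableOn_Ioc)
      (Filter.Eventually.of_forall fun s => (Real.exp_pos _).le) (LE.le.eventuallyLE ?_)
    rintro s ⟨hs, hst⟩
    exact ⟨min_lt_of_right_lt (max_lt hs.1 hst), hs.2.le⟩
  rw [h1, setIntegral_indicator measurableSet_Ioi]
  refine h2.trans ?_
  rw [← intervalIntegral.integral_of_le (clampTime_le T t),
    intervalIntegral.integral_comp_sub_left (fun x => Real.exp (l * x)) T,
    intervalIntegral.integral_comp_mul_left (fun x => Real.exp x) hl.ne', integral_exp, smul_eq_mul,
    sub_self, mul_zero, Real.exp_zero, div_eq_inv_mul]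
  exact mul_le_mul_of_nonneg_left (by linarith) (by positivity)

section Kernels

variable {E : Type*} [MeasurableSpace E] {ν : Measure E} [IsFiniteMeasure ν] {T : ℝ}

theorem BddMeas.volterraKernel {β : (E × E) × ℝ → ℝ} (hβ : BddMeas β) :
    BddMeas (volterraKernel β) := by
  refine BddMeas.ite ?_ (hβ.comp (e := fun x : (E × ℝ) × (E × ℝ) => ((x.1.1, x.2.1), x.1.2))
    (by fun_prop)) (BddMeas.const 0)
  exact measurableSet_lt (by fun_prop) (by fun_prop)

theorem BddMeas.pastIntegral {h : E × ℝ → ℝ} (hh : BddMeas h) : BddMeas (pastIntegral T h) := by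
  refine BddMeas.integral_right (k := fun x : (E × ℝ) × ℝ =>
    if x.2 < x.1.2 then h (x.1.1, x.2) else 0) ?_
  refine BddMeas.ite ?_ (hh.comp (e := fun x : (E × ℝ) × ℝ => (x.1.1, x.2))
    (by fun_prop)) (BddMeas.const 0)
  exact measurableSet_lt (by fun_prop) (by fun_prop)

theorem pastIntegral_eq_intervalIntegral {E : Type*} {h : E × ℝ → ℝ} {t : ℝ} (ht : t ∈ Icc 0 T) (y : E) :
    pastIntegral T h (y, t) = ∫ s in (0 : ℝ)..t, h (y, s) := by
  have h1 : pastIntegral T h (y, t) = ∫ s in Ioo 0 T, (Iio t).indicator (fun s => h (y, s)) s := by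
    simp only [pastIntegral, indicator, mem_Iio]
  have h2 : Ioo 0 T ∩ Iio t = Ioo 0 t := by
    ext s
    simp only [mem_inter_iff, mem_Ioo, mem_Iio]
    exact ⟨fun h => ⟨h.1.1, h.2⟩, fun h => ⟨⟨h.1, h.2.trans_le ht.2⟩, h.2⟩⟩
  rw [h1, setIntegral_indicator measurableSet_Iio, h2, intervalIntegral.integral_of_le ht.1,
    integral_Ioc_eq_integral_Ioo]

theorem pastIntegral_terminal {E : Type*} (h : E × ℝ → ℝ) (y : E) :
    pastIntegral T h (y, T) = ∫ s, h (y, s) ∂(timeMeasure T) :=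
  setIntegral_congr_fun measurableSet_Ioo fun _ hs => if_pos hs.2

theorem integral_mul_pastIntegral {β : (E × E) × ℝ → ℝ} (hβ : BddMeas β) {h : E × ℝ → ℝ}
    (hh : BddMeas h) (p : E × ℝ) :
    ∫ z, β ((p.1, z), p.2) * pastIntegral T h (z, p.2) ∂ν =
      ∫ q, volterraKernel β (p, q) * h q ∂(ν.prod (timeMeasure T)) := by
  have hint : Integrable (fun q => volterraKernel β (p, q) * h q) (ν.prod (timeMeasure T)) :=
    ((hβ.volterraKernel.comp measurable_prodMk_left).mul hh).integrable
  rw [integral_prod _ hint]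
  refine integral_congr_ae (Filter.Eventually.of_forall fun z => ?_)
  simp only [pastIntegral, volterraKernel]
  rw [← integral_const_mul]
  refine integral_congr_ae (Filter.Eventually.of_forall fun s => ?_)
  dsimp only
  split_ifs <;> simp

theorem integral_mul_pastIntegral_terminal {ρ : E → ℝ} (hρ : Integrable ρ ν) {h : E × ℝ → ℝ}
    (hh : BddMeas h) :
    ∫ y, ρ y * pastIntegral T h (y, T) ∂ν = ∫ q, ρ q.1 * h q ∂(ν.prod (timeMeasure T)) := by
  have hint : Integrable (fun q : E × ℝ => ρ q.1 * h q) (ν.prod (timeMeasure T)) := by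
    simpa only [mul_comm] using hh.mul_integrable (hρ.comp_fst (timeMeasure T))
  rw [integral_prod _ hint]
  refine integral_congr_ae (Filter.Eventually.of_forall fun y => ?_)
  dsimp only
  rw [pastIntegral_terminal, integral_const_mul]

theorem volterraKernel_add_smul {E : Type*} (b b' : (E × E) × ℝ → ℝ) (τ : ℝ) (x : (E × ℝ) × (E × ℝ)) :
    volterraKernel (fun y => b y + τ * b' y) x = volterraKernel b x + τ * volterraKernel b' x := by
  simp only [volterraKernel]
  split_ifs <;> simp

theorem abs_volterraKernel_le {E : Type*} {β : (E × E) × ℝ → ℝ} {M : ℝ} (hM : ∀ x, |β x| ≤ M)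
    (x : (E × ℝ) × (E × ℝ)) : |volterraKernel β x| ≤ if x.2.2 < x.1.2 then M else 0 := by
  unfold volterraKernel
  split_ifs
  · exact hM _
  · simp

/-- An exponential weight for which every Volterra kernel bounded by `M` is a contraction. -/
theorem exists_forward_weight (ν : Measure E) [IsFiniteMeasure ν] (hT : 0 ≤ T) {M K : ℝ}
    (hM : 0 ≤ M) (hK : 0 ≤ K) :
    ∃ (θ : E × ℝ → ℝ) (δ : ℝ), BddMeas θ ∧ (∀ p, 1 ≤ θ p) ∧ K * δ ≤ 1 / 2 ∧
      ∀ β : (E × E) × ℝ → ℝ, BddMeas β → (∀ x, |β x| ≤ M) → ∀ p,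
        ∫ q, |volterraKernel β (p, q)| * θ q ∂(ν.prod (timeMeasure T)) ≤ δ * θ p := by
  set V := ν.real univ with hV
  have hV0 : 0 ≤ V := measureReal_nonneg
  -- A decay rate `l` with `K * (M * V / l) ≤ 1 / 2`.
  set l := 2 * (K * M * V) + 1 with hl
  have hl0 : 0 < l := by positivity
  have hθ : BddMeas fun p : E × ℝ => Real.exp (l * clampTime T p.2) := by
    refine ⟨?_, Real.exp (l * T), fun p => ?_⟩
    · exact (Real.continuous_exp.comp (continuous_const.mul (continuous_clampTime T))).measurable.comp
        measurable_snd
    · rw [abs_of_pos (Real.exp_pos _), Real.exp_le_exp]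
      exact mul_le_mul_of_nonneg_left (clampTime_le _ _) hl0.le
  refine ⟨fun p => Real.exp (l * clampTime T p.2), M * V / l, hθ, fun p => ?_, ?_, ?_⟩
  · exact Real.one_le_exp (mul_nonneg hl0.le (clampTime_nonneg hT _))
  · rw [← mul_div_assoc, div_le_iff₀ hl0]
    rw [hl]; ring_nf; linarith
  · intro β hβ hβM p
    have hmono : ∫ q, |volterraKernel β (p, q)| * Real.exp (l * clampTime T q.2)
          ∂(ν.prod (timeMeasure T)) ≤
        ∫ q, M * (if q.2 < p.2 then Real.exp (l * clampTime T q.2) else 0)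
          ∂(ν.prod (timeMeasure T)) := by
      refine integral_mono ?_ ?_ fun q => ?_
      · exact (((hβ.volterraKernel.comp measurable_prodMk_left).continuous_comp
          continuous_abs).mul hθ).integrable
      · exact ((BddMeas.ite (measurableSet_lt (by fun_prop) (by fun_prop)) hθ
          (BddMeas.const 0)).const_mul M).integrable
      · have := abs_volterraKernel_le hβM (p, q)
        dsimp only at this ⊢
        refine (mul_le_mul_of_nonneg_right this (Real.exp_pos _).le).trans (le_of_eq ?_)
        split_ifs <;> simp
    refine hmono.trans ?_
    rw [integral_const_mul, integral_fun_snd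
      (f := fun s => if s < p.2 then Real.exp (l * clampTime T s) else 0), smul_eq_mul, ← hV]
    have := integral_exp_mul_clampTime_le hT hl0 p.2
    calc M * (V * _) ≤ M * (V * (Real.exp (l * clampTime T p.2) / l)) := by gcongr
      _ = _ := by ring

/-- The analogue of `exists_forward_weight` for transposed kernels, which integrate over later
times. -/
theorem exists_backward_weight (ν : Measure E) [IsFiniteMeasure ν] (hT : 0 ≤ T) {M K : ℝ}
    (hM : 0 ≤ M) (hK : 0 ≤ K) :
    ∃ (θ : E × ℝ → ℝ) (δ : ℝ), BddMeas θ ∧ (∀ p, 1 ≤ θ p) ∧ K * δ ≤ 1 / 2 ∧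
      ∀ β : (E × E) × ℝ → ℝ, BddMeas β → (∀ x, |β x| ≤ M) → ∀ p,
        ∫ q, |volterraKernel β (q, p)| * θ q ∂(ν.prod (timeMeasure T)) ≤ δ * θ p := by
  set V := ν.real univ with hV
  have hV0 : 0 ≤ V := measureReal_nonneg
  -- A decay rate `l` with `K * (M * V / l) ≤ 1 / 2`.
  set l := 2 * (K * M * V) + 1 with hl
  have hl0 : 0 < l := by positivity
  have hθ : BddMeas fun p : E × ℝ => Real.exp (l * (T - clampTime T p.2)) := by
    refine ⟨?_, Real.exp (l * T), fun p => ?_⟩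
    · exact (Real.continuous_exp.comp (continuous_const.mul
        (continuous_const.sub (continuous_clampTime T)))).measurable.comp measurable_snd
    · rw [abs_of_pos (Real.exp_pos _), Real.exp_le_exp]
      exact mul_le_mul_of_nonneg_left (by linarith [clampTime_nonneg hT p.2]) hl0.le
  refine ⟨fun p => Real.exp (l * (T - clampTime T p.2)), M * V / l, hθ, fun p => ?_, ?_, ?_⟩
  · exact Real.one_le_exp (mul_nonneg hl0.le (by linarith [clampTime_le T p.2]))
  · rw [← mul_div_assoc, div_le_iff₀ hl0]
    rw [hl]; ring_nf; linarith
  · intro β hβ hβM p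
    have hmono : ∫ q, |volterraKernel β (q, p)| * Real.exp (l * (T - clampTime T q.2))
          ∂(ν.prod (timeMeasure T)) ≤
        ∫ q, M * (if p.2 < q.2 then Real.exp (l * (T - clampTime T q.2)) else 0)
          ∂(ν.prod (timeMeasure T)) := by
      refine integral_mono ?_ ?_ fun q => ?_
      · exact (((hβ.volterraKernel.comp measurable_prodMk_right).continuous_comp
          continuous_abs).mul hθ).integrable
      · exact ((BddMeas.ite (measurableSet_lt (by fun_prop) (by fun_prop)) hθ
          (BddMeas.const 0)).const_mul M).integrable
      · have := abs_volterraKernel_le hβM (q, p)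
        dsimp only at this ⊢
        refine (mul_le_mul_of_nonneg_right this (Real.exp_pos _).le).trans (le_of_eq ?_)
        split_ifs <;> simp
    refine hmono.trans ?_
    rw [integral_const_mul, integral_fun_snd
      (f := fun s => if p.2 < s then Real.exp (l * (T - clampTime T s)) else 0), smul_eq_mul, ← hV]
    have := integral_exp_mul_sub_clampTime_le (T := T) hl0 p.2
    calc M * (V * _) ≤ M * (V * (Real.exp (l * (T - clampTime T p.2)) / l)) := by gcongr
      _ = _ := by ring

end Kernels

section Volterra

variable {E : Type*} [MeasurableSpace E] {ν : Measure E} [IsFiniteMeasure ν] {T : ℝ}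

/-! ### The forward problem for bounded measurable controls -/

/-- `ξ` is the preactivation of the control `(a, b)` with initial state `g`. Eliminating the state
`f(y, t) = g(y) + ∫₀ᵗ σ(ξ(y, s)) ds` from `ξ = a - ∫ b f` leaves a Volterra equation for `ξ`. -/
structure IsPreactivation (ν : Measure E) (T : ℝ) (σ : ℝ → ℝ) (a : E × ℝ → ℝ)
    (b : (E × E) × ℝ → ℝ) (g : E → ℝ) (ξ : E × ℝ → ℝ) : Prop where
  bddMeas : BddMeas ξ
  eq : ∀ p, ξ p = a p - (∫ z, b ((p.1, z), p.2) * g z ∂ν) -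
    ∫ q, volterraKernel b (p, q) * σ (ξ q) ∂(ν.prod (timeMeasure T))

/-- The state `f(y, t) = g(y) + ∫₀ᵗ σ(ξ(y, s)) ds`. -/
noncomputable def stateOf (T : ℝ) (σ : ℝ → ℝ) (g : E → ℝ) (ξ : E × ℝ → ℝ) (p : E × ℝ) : ℝ :=
  g p.1 + pastIntegral T (fun q => σ (ξ q)) p

/-- `a - ∫ b f` for the state `f` of `ξ`. -/
noncomputable def controlAction (ν : Measure E) (T : ℝ) (σ : ℝ → ℝ) (a : E × ℝ → ℝ)
    (b : (E × E) × ℝ → ℝ) (g : E → ℝ) (ξ : E × ℝ → ℝ) (p : E × ℝ) : ℝ :=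
  a p - ∫ z, b ((p.1, z), p.2) * stateOf T σ g ξ (z, p.2) ∂ν

theorem BddMeas.integral_weight_mul {b : (E × E) × ℝ → ℝ} (hb : BddMeas b) {g : E → ℝ}
    (hg : Measurable g) (hgi : Integrable g ν) :
    BddMeas fun p : E × ℝ => ∫ z, b ((p.1, z), p.2) * g z ∂ν :=
  (hb.comp (e := fun x : (E × ℝ) × E => ((x.1.1, x.2), x.1.2)) (by fun_prop)).integral_mul hg hgi

section

variable {σ : ℝ → ℝ} {a a' : E × ℝ → ℝ} {b b' : (E × E) × ℝ → ℝ} {g : E → ℝ} {ξ : E × ℝ → ℝ}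

theorem controlAction_eq (hσ : Continuous σ) (hb : BddMeas b) (hgi : Integrable g ν)
    (hξ : BddMeas ξ) (p : E × ℝ) :
    controlAction ν T σ a b g ξ p = a p - (∫ z, b ((p.1, z), p.2) * g z ∂ν) -
      ∫ q, volterraKernel b (p, q) * σ (ξ q) ∂(ν.prod (timeMeasure T)) := by
  have hbp : BddMeas fun z => b ((p.1, z), p.2) := hb.comp (by fun_prop)
  have hσξ : BddMeas fun q => σ (ξ q) := hξ.continuous_comp hσ
  have hP : BddMeas fun z => pastIntegral T (fun q => σ (ξ q)) (z, p.2) :=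
    hσξ.pastIntegral.comp measurable_prodMk_right
  simp only [controlAction, stateOf, mul_add]
  rw [integral_add (hbp.mul_integrable hgi) (hbp.mul hP).integrable,
    integral_mul_pastIntegral hb hσξ, sub_sub]

theorem IsPreactivation.eq_controlAction (hσ : Continuous σ) (hb : BddMeas b)
    (hgi : Integrable g ν) (h : IsPreactivation ν T σ a b g ξ) (p : E × ℝ) :
    ξ p = controlAction ν T σ a b g ξ p := by
  rw [controlAction_eq hσ hb hgi h.bddMeas, ← h.eq p]

theorem BddMeas.controlAction (hσ : Continuous σ) (ha : BddMeas a) (hb : BddMeas b)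
    (hg : Measurable g) (hgi : Integrable g ν) (hξ : BddMeas ξ) :
    BddMeas (controlAction ν T σ a b g ξ) := by
  have h1 := (ha.sub (hb.integral_weight_mul hg hgi)).sub
    (hb.volterraKernel.integral_mul (hξ.continuous_comp hσ).meas
      ((hξ.continuous_comp hσ).integrable (ν := ν.prod (timeMeasure T))))
  convert h1 using 1
  funext p
  exact controlAction_eq hσ hb hgi hξ p

theorem lipschitz_abs {K : NNReal} (hσL : LipschitzWith K σ) (u v : ℝ) :
    |σ u - σ v| ≤ K * |u - v| := by
  simpa [Real.dist_eq] using hσL.dist_le_mul u v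

theorem exists_isPreactivation {K : NNReal} (hσL : LipschitzWith K σ) (hT : 0 ≤ T)
    (ha : BddMeas a) (hb : BddMeas b) (hg : Measurable g) (hgi : Integrable g ν) :
    ∃ ξ, IsPreactivation ν T σ a b g ξ := by
  obtain ⟨M, hM0, hM⟩ := hb.exists_pos
  obtain ⟨θ, δ, hθ, hθ1, hδ, hk⟩ := exists_forward_weight ν hT hM0.le K.coe_nonneg
  obtain ⟨ξ, hξ, hξe⟩ := exists_hammerstein_solution (m := ν.prod (timeMeasure T))
    hb.volterraKernel hθ hθ1 K.coe_nonneg hδ (hk b hb hM) (φ := fun _ x => σ x)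
    (fun x hx => hx.continuous_comp hσL.continuous) (fun _ u v => lipschitz_abs hσL u v)
    (ha.sub (hb.integral_weight_mul hg hgi))
  exact ⟨ξ, hξ, hξe⟩

/-- The preactivations of the controls `(a + τ a', b + τ b')` satisfy an identity in which the
increment of the control acts on the unperturbed state only. -/
theorem IsPreactivation.sub_eq (hσ : Continuous σ) (hb : BddMeas b) (hb' : BddMeas b')
    (hgi : Integrable g ν) (h : IsPreactivation ν T σ a b g ξ) {τ : ℝ} {ξ' : E × ℝ → ℝ}
    (h' : IsPreactivation ν T σ (fun p => a p + τ * a' p) (fun x => b x + τ * b' x) g ξ')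
    (p : E × ℝ) :
    ξ' p - ξ p = τ * controlAction ν T σ a' b' g ξ p -
      ((∫ q, volterraKernel (fun x => b x + τ * b' x) (p, q) * σ (ξ' q) ∂(ν.prod (timeMeasure T))) -
        ∫ q, volterraKernel (fun x => b x + τ * b' x) (p, q) * σ (ξ q)
          ∂(ν.prod (timeMeasure T))) := by
  have hbp : BddMeas fun z => b ((p.1, z), p.2) := hb.comp (by fun_prop)
  have hbp' : BddMeas fun z => b' ((p.1, z), p.2) := hb'.comp (by fun_prop)
  have hσξ : BddMeas fun q => σ (ξ q) := h.bddMeas.continuous_comp hσ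
  have hk : BddMeas fun q => volterraKernel b (p, q) :=
    hb.volterraKernel.comp measurable_prodMk_left
  have hk' : BddMeas fun q => volterraKernel b' (p, q) :=
    hb'.volterraKernel.comp measurable_prodMk_left
  have e1 : ∫ z, (b ((p.1, z), p.2) + τ * b' ((p.1, z), p.2)) * g z ∂ν =
      (∫ z, b ((p.1, z), p.2) * g z ∂ν) + τ * ∫ z, b' ((p.1, z), p.2) * g z ∂ν := by
    rw [← integral_const_mul, ← integral_add (hbp.mul_integrable hgi)
      ((hbp'.mul_integrable hgi).const_mul τ)]
    exact integral_congr_ae (Filter.Eventually.of_forall fun z => by ring)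
  have e2 : ∫ q, volterraKernel (fun x => b x + τ * b' x) (p, q) * σ (ξ q)
        ∂(ν.prod (timeMeasure T)) =
      (∫ q, volterraKernel b (p, q) * σ (ξ q) ∂(ν.prod (timeMeasure T))) +
        τ * ∫ q, volterraKernel b' (p, q) * σ (ξ q) ∂(ν.prod (timeMeasure T)) := by
    rw [← integral_const_mul, ← integral_add (hk.mul hσξ).integrable
      ((hk'.mul hσξ).integrable.const_mul τ)]
    refine integral_congr_ae (Filter.Eventually.of_forall fun q => ?_)
    dsimp only
    rw [volterraKernel_add_smul]; ring
  rw [e2, controlAction_eq hσ hb' hgi h.bddMeas, h.eq p, h'.eq p, e1]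
  ring

/-- Preactivations depend on the control in a Lipschitz way, uniformly on bounded sets. -/
theorem IsPreactivation.exists_abs_sub_le {K : NNReal} (hσL : LipschitzWith K σ) (hT : 0 ≤ T)
    (ha' : BddMeas a') (hb : BddMeas b) (hb' : BddMeas b') (hg : Measurable g)
    (hgi : Integrable g ν) (h : IsPreactivation ν T σ a b g ξ) :
    ∃ C, 0 < C ∧ ∀ τ ∈ Icc (0 : ℝ) 1, ∀ ξ',
      IsPreactivation ν T σ (fun p => a p + τ * a' p) (fun x => b x + τ * b' x) g ξ' →
        ∀ p, |ξ' p - ξ p| ≤ C * τ := by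
  have hσ := hσL.continuous
  obtain ⟨M, hM0, hM⟩ := hb.exists_pos
  obtain ⟨M', hM0', hM'⟩ := hb'.exists_pos
  obtain ⟨V, hV0, hV⟩ := (BddMeas.controlAction (T := T) hσ ha' hb' hg hgi h.bddMeas).exists_pos
  obtain ⟨θ, δ, hθ, hθ1, hδ, hk⟩ :=
    exists_forward_weight ν hT (add_pos hM0 hM0').le K.coe_nonneg
  obtain ⟨B, hB0, hB⟩ := hθ.exists_pos
  refine ⟨2 * V * B, by positivity, fun τ hτ ξ' h' p => ?_⟩
  have hbτ : BddMeas fun x => b x + τ * b' x := hb.add (hb'.const_mul τ)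
  have hbτM : ∀ x, |b x + τ * b' x| ≤ M + M' := by
    intro x
    refine (abs_add_le _ _).trans (add_le_add (hM x) ?_)
    rw [abs_mul, abs_of_nonneg hτ.1]
    exact (mul_le_of_le_one_left (abs_nonneg _) hτ.2).trans (hM' x)
  obtain ⟨D, hD⟩ := (h'.bddMeas.sub h.bddMeas).bdd
  have key := abs_le_two_mul_of_forall_half (D := fun p => ξ' p - ξ p) (θ := θ) (η := V * τ) hθ1
    (mul_nonneg hV0.le hτ.1) hD (fun S hS hSb p => ?_) p
  · refine key.trans ?_
    have : θ p ≤ B := (le_abs_self _).trans (hB p)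
    calc 2 * (V * τ) * θ p ≤ 2 * (V * τ) * B :=
          mul_le_mul_of_nonneg_left this (by have := hτ.1; positivity)
      _ = _ := by ring
  · have hc := abs_integral_kernel_sub_le (m := ν.prod (timeMeasure T)) hbτ.volterraKernel hθ hθ1
      K.coe_nonneg hδ (hk _ hbτ hbτM) (φ := fun _ x => σ x)
      (fun x hx => hx.continuous_comp hσ) (fun _ u v => lipschitz_abs hσL u v)
      h'.bddMeas h.bddMeas hS hSb p
    rw [h.sub_eq hσ hb hb' hgi h' p]
    refine (abs_sub _ _).trans ?_
    have h1 : |τ * controlAction ν T σ a' b' g ξ p| ≤ V * τ := by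
      rw [abs_mul, abs_of_nonneg hτ.1, mul_comm]
      exact mul_le_mul_of_nonneg_right (hV p) hτ.1
    have h2 : V * τ ≤ V * τ * θ p := le_mul_of_one_le_right (mul_nonneg hV0.le hτ.1) (hθ1 p)
    linarith [hc, add_mul (S / 2) (V * τ) (θ p)]

/-! ### The adjoint problem for bounded measurable controls -/

/-- `r` solves the backward equation `∂ₜ r(y, t) = ∫ b(z, y, t) κ(z, t) r(z, t) dz` with terminal
value `ρ`, written with the transposed Volterra kernel. -/
structure IsAdjoint (ν : Measure E) (T : ℝ) (b : (E × E) × ℝ → ℝ) (κ : E × ℝ → ℝ) (ρ : E → ℝ)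
    (r : E × ℝ → ℝ) : Prop where
  bddMeas : BddMeas fun p => r p - ρ p.1
  eq : ∀ p, r p = ρ p.1 -
    ∫ q, volterraKernel b (q, p) * (κ q * r q) ∂(ν.prod (timeMeasure T))

theorem IsAdjoint.measurable {ν : Measure E} {κ : E × ℝ → ℝ} {ρ : E → ℝ} {r : E × ℝ → ℝ} (hρ : Measurable ρ)
    (hr : IsAdjoint ν T b κ ρ r) : Measurable r := by
  have := hr.bddMeas.meas.add (hρ.comp measurable_fst)
  convert this using 1
  funext p
  simp

theorem IsAdjoint.integrable {κ : E × ℝ → ℝ} {ρ : E → ℝ} {r : E × ℝ → ℝ} (hρi : Integrable ρ ν)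
    (hr : IsAdjoint ν T b κ ρ r) : Integrable r (ν.prod (timeMeasure T)) := by
  have := (hr.bddMeas.integrable (ν := ν.prod (timeMeasure T))).add (hρi.comp_fst (timeMeasure T))
  exact this.congr (Filter.Eventually.of_forall fun p => by simp)

theorem exists_isAdjoint (hT : 0 ≤ T) {κ : E × ℝ → ℝ} (hκ : BddMeas κ) (hb : BddMeas b) {ρ : E → ℝ}
    (hρ : Measurable ρ) (hρi : Integrable ρ ν) : ∃ r, IsAdjoint ν T b κ ρ r := by
  obtain ⟨M, hM0, hM⟩ := hb.exists_pos
  obtain ⟨K, hK0, hK⟩ := hκ.exists_pos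
  obtain ⟨θ, δ, hθ, hθ1, hδ, hk⟩ := exists_backward_weight ν hT hM0.le hK0.le
  have hkt : BddMeas fun x : (E × ℝ) × (E × ℝ) => volterraKernel b (x.2, x.1) :=
    hb.volterraKernel.comp measurable_swap
  have hκρ : Integrable (fun q : E × ℝ => κ q * ρ q.1) (ν.prod (timeMeasure T)) :=
    hκ.mul_integrable (hρi.comp_fst (timeMeasure T))
  have hα : BddMeas fun p : E × ℝ => -∫ q, volterraKernel b (q, p) * (κ q * ρ q.1)
      ∂(ν.prod (timeMeasure T)) :=
    (hkt.integral_mul (hκ.meas.mul (hρ.comp measurable_fst)) hκρ).neg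
  obtain ⟨x, hx, hxe⟩ := exists_hammerstein_solution (m := ν.prod (timeMeasure T))
    hkt hθ hθ1 hK0.le hδ (hk b hb hM) (φ := fun q x => κ q * x) (fun x hx => hκ.mul hx)
    (fun q u v => by
      rw [← mul_sub, abs_mul]
      exact mul_le_mul_of_nonneg_right (hK q) (abs_nonneg _)) hα
  refine ⟨fun p => ρ p.1 + x p, by simpa using hx, fun p => ?_⟩
  have hkp : BddMeas fun q => volterraKernel b (q, p) :=
    hb.volterraKernel.comp measurable_prodMk_right
  simp only [mul_add]
  rw [integral_add (hkp.mul_integrable hκρ) (hkp.mul (hκ.mul hx)).integrable, hxe p]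
  ring

/-- Duality between the forward and the adjoint Volterra operator. -/
theorem IsAdjoint.integral_terminal_mul {κ : E × ℝ → ℝ} (hκ : BddMeas κ) (hb : BddMeas b)
    {ρ : E → ℝ} (hρ : Measurable ρ) (hρi : Integrable ρ ν) {r : E × ℝ → ℝ}
    (hr : IsAdjoint ν T b κ ρ r) {d : E × ℝ → ℝ} (hd : BddMeas d) :
    ∫ p, ρ p.1 * d p ∂(ν.prod (timeMeasure T)) =
      (∫ p, r p * d p ∂(ν.prod (timeMeasure T))) +
        ∫ q, κ q * r q * (∫ p, volterraKernel b (q, p) * d p ∂(ν.prod (timeMeasure T)))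
          ∂(ν.prod (timeMeasure T)) := by
  set m := ν.prod (timeMeasure T)
  have hri : Integrable r m := hr.integrable hρi
  have hκr : Integrable (fun q => κ q * r q) m := hκ.mul_integrable hri
  have hκrm : Measurable fun q => κ q * r q := hκ.meas.mul (hr.measurable hρ)
  have hadj : BddMeas fun p => ∫ q, volterraKernel b (q, p) * (κ q * r q) ∂m :=
    (hb.volterraKernel.comp (e := fun x : (E × ℝ) × (E × ℝ) => (x.2, x.1))
      measurable_swap).integral_mul hκrm hκr
  have hrd : Integrable (fun p => r p * d p) m := by
    simpa only [mul_comm] using hd.mul_integrable hri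
  have hint : Integrable (Function.uncurry fun p q =>
      volterraKernel b (q, p) * (κ q * r q) * d p) (m.prod m) := by
    have h1 : BddMeas fun x : (E × ℝ) × (E × ℝ) => volterraKernel b (x.2, x.1) * d x.1 :=
      (hb.volterraKernel.comp measurable_swap).mul (hd.comp measurable_fst)
    have h2 := h1.mul_integrable (hκr.comp_snd m)
    refine h2.congr (Filter.Eventually.of_forall fun x => ?_)
    simp only [Function.uncurry]; ring
  have hswap := integral_integral_swap hint
  have e1 : ∀ p, ρ p.1 * d p =
      r p * d p + ∫ q, volterraKernel b (q, p) * (κ q * r q) * d p ∂m := by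
    intro p
    rw [integral_mul_const, hr.eq p]; ring
  have hI2 : Integrable (fun p => ∫ q, volterraKernel b (q, p) * (κ q * r q) * d p ∂m) m := by
    simp only [integral_mul_const]
    exact (hadj.mul hd).integrable
  rw [integral_congr_ae (Filter.Eventually.of_forall e1), integral_add hrd hI2, hswap]
  congr 1
  refine integral_congr_ae (Filter.Eventually.of_forall fun q => ?_)
  dsimp only
  rw [← integral_const_mul]
  exact integral_congr_ae (Filter.Eventually.of_forall fun p => by ring)

/-- First-order expansion of a `C¹` function, uniform on bounded sets. -/
theorem exists_uniform_taylor (hσ1 : ContDiff ℝ 1 σ) (R : ℝ) {η : ℝ} (hη : 0 < η) :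
    ∃ δ > 0, ∀ x, |x| ≤ R → ∀ x', |x' - x| ≤ δ →
      |σ x' - σ x - deriv σ x * (x' - x)| ≤ η * |x' - x| := by
  have hd : Continuous (deriv σ) := hσ1.continuous_deriv le_rfl
  have hdiff : Differentiable ℝ σ := hσ1.differentiable one_ne_zero
  have huc := (isCompact_Icc (a := -(R + 1)) (b := R + 1)).uniformContinuousOn_of_continuous
    hd.continuousOn
  obtain ⟨δ, hδ, hδu⟩ := Metric.uniformContinuousOn_iff.1 huc η hη
  refine ⟨min (δ / 2) 1, by positivity, fun x hx x' hx' => ?_⟩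
  have hx1 := abs_le.1 hx
  have hsub : ∀ u ∈ uIcc x x', |u - x| ≤ |x' - x| := fun u hu =>
    abs_sub_left_of_mem_uIcc hu
  have hbd : ∀ u ∈ uIcc x x', ‖deriv (fun u => σ u - deriv σ x * u) u‖ ≤ η := by
    intro u hu
    have hu1 := (hsub u hu).trans hx'
    have hu2 := abs_le.1 (hu1.trans (min_le_right _ _))
    have hder : HasDerivAt (fun u => σ u - deriv σ x * u) (deriv σ u - deriv σ x * 1) u :=
      (hdiff u).hasDerivAt.sub ((hasDerivAt_id u).const_mul _)
    rw [hder.deriv, mul_one]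
    have := hδu u ⟨by linarith, by linarith⟩ x ⟨by linarith, by linarith⟩
      (by rw [Real.dist_eq]; linarith [hu1.trans (min_le_left _ _)])
    rw [Real.dist_eq] at this
    exact this.le
  have := (convex_uIcc x x').norm_image_sub_le_of_norm_deriv_le
    (f := fun u => σ u - deriv σ x * u)
    (fun u _ => (hdiff u).sub ((differentiableAt_id).const_mul _)) hbd left_mem_uIcc right_mem_uIcc
  rw [Real.norm_eq_abs, Real.norm_eq_abs] at this
  refine le_trans (le_of_eq ?_) this
  congr 1; ring

/-- The first variation of a linear functional of the terminal state. The state is never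
differentiated with respect to the control: the adjoint equation absorbs the increment of the
preactivation exactly, and only the Taylor remainder of `σ` is left. -/
theorem IsAdjoint.exists_abs_variation_sub_le {K : NNReal} (hσL : LipschitzWith K σ)
    (hσ1 : ContDiff ℝ 1 σ) (hT : 0 ≤ T) (ha' : BddMeas a') (hb : BddMeas b) (hb' : BddMeas b')
    (hg : Measurable g) (hgi : Integrable g ν) (h : IsPreactivation ν T σ a b g ξ)
    {ρ : E → ℝ} (hρ : Measurable ρ) (hρi : Integrable ρ ν) {r : E × ℝ → ℝ}
    (hr : IsAdjoint ν T b (fun q => deriv σ (ξ q)) ρ r) {η : ℝ} (hη : 0 < η) :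
    ∃ τ₀, 0 < τ₀ ∧ ∀ τ, 0 < τ → τ ≤ τ₀ → τ ≤ 1 → ∀ ξ',
      IsPreactivation ν T σ (fun p => a p + τ * a' p) (fun x => b x + τ * b' x) g ξ' →
        |(∫ p, ρ p.1 * (σ (ξ' p) - σ (ξ p)) ∂(ν.prod (timeMeasure T))) -
          τ * ∫ p, deriv σ (ξ p) * r p * controlAction ν T σ a' b' g ξ p
            ∂(ν.prod (timeMeasure T))| ≤ η * τ := by
  set m := ν.prod (timeMeasure T)
  have hσ := hσL.continuous
  have hκ : BddMeas fun q => deriv σ (ξ q) :=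
    h.bddMeas.continuous_comp (hσ1.continuous_deriv le_rfl)
  obtain ⟨C, hC0, hC⟩ := h.exists_abs_sub_le hσL hT ha' hb hb' hg hgi
  obtain ⟨R, hR0, hR⟩ := h.bddMeas.exists_pos
  obtain ⟨D, hD0, hD⟩ := hκ.exists_pos
  obtain ⟨M', hM0', hM'⟩ := hb'.volterraKernel.exists_pos
  set I := ∫ p, |r p| ∂m with hI
  have hI0 : 0 ≤ I := integral_nonneg fun p => abs_nonneg _
  set V := m.real univ
  have hV0 : 0 ≤ V := measureReal_nonneg
  obtain ⟨δ, hδ0, hδ⟩ := exists_uniform_taylor hσ1 R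
    (η := η / (2 * (C * (I + 1)))) (by positivity)
  -- `Q * τ ^ 2` bounds the contribution of `b'` acting on the increment of the state.
  set Q := D * I * (M' * (K * C) * V) with hQ
  have hQ0 : 0 ≤ Q := by positivity
  refine ⟨min (δ / C) (η / (2 * (Q + 1))), by positivity, fun τ hτ0 hτ hτ1 ξ' h' => ?_⟩
  have hξd : ∀ p, |ξ' p - ξ p| ≤ C * τ := hC τ ⟨hτ0.le, hτ1⟩ ξ' h'
  have hd : BddMeas fun p => σ (ξ' p) - σ (ξ p) :=
    (h'.bddMeas.continuous_comp hσ).sub (h.bddMeas.continuous_comp hσ)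
  have hdC : ∀ p, |σ (ξ' p) - σ (ξ p)| ≤ K * C * τ := fun p => by
    refine (lipschitz_abs hσL _ _).trans ?_
    rw [mul_assoc]
    exact mul_le_mul_of_nonneg_left (hξd p) K.coe_nonneg
  have hri : Integrable r m := hr.integrable hρi
  have hb'dC : ∀ q, |∫ p, volterraKernel b' (q, p) * (σ (ξ' p) - σ (ξ p)) ∂m| ≤
      M' * (K * C * τ) * V := fun q => by
    rw [← Real.norm_eq_abs]
    refine norm_integral_le_of_norm_le_const (Filter.Eventually.of_forall fun p => ?_)
    rw [Real.norm_eq_abs, abs_mul]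
    exact mul_le_mul (hM' _) (hdC p) (abs_nonneg _) hM0'.le
  have hv : BddMeas (controlAction ν T σ a' b' g ξ) :=
    BddMeas.controlAction hσ ha' hb' hg hgi h.bddMeas
  -- The equation of the increment of `ξ`, solved for the action of the unperturbed kernel.
  have hinc : ∀ q, ∫ p, volterraKernel b (q, p) * (σ (ξ' p) - σ (ξ p)) ∂m =
      τ * controlAction ν T σ a' b' g ξ q - (ξ' q - ξ q) -
        τ * ∫ p, volterraKernel b' (q, p) * (σ (ξ' p) - σ (ξ p)) ∂m := by
    intro q
    have hbτ : BddMeas fun x => b x + τ * b' x := hb.add (hb'.const_mul τ)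
    have hkτ : BddMeas fun p => volterraKernel (fun x => b x + τ * b' x) (q, p) :=
      hbτ.volterraKernel.comp measurable_prodMk_left
    have hk : BddMeas fun p => volterraKernel b (q, p) :=
      hb.volterraKernel.comp measurable_prodMk_left
    have hk' : BddMeas fun p => volterraKernel b' (q, p) :=
      hb'.volterraKernel.comp measurable_prodMk_left
    rw [h.sub_eq hσ hb hb' hgi h' q, ← integral_sub
      (hkτ.mul (h'.bddMeas.continuous_comp hσ)).integrable
      (hkτ.mul (h.bddMeas.continuous_comp hσ)).integrable]
    have e : ∫ p, (volterraKernel (fun x => b x + τ * b' x) (q, p) * σ (ξ' p) -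
          volterraKernel (fun x => b x + τ * b' x) (q, p) * σ (ξ p)) ∂m =
        (∫ p, volterraKernel b (q, p) * (σ (ξ' p) - σ (ξ p)) ∂m) +
          τ * ∫ p, volterraKernel b' (q, p) * (σ (ξ' p) - σ (ξ p)) ∂m := by
      rw [← integral_const_mul, ← integral_add (hk.mul hd).integrable
        ((hk'.mul hd).integrable.const_mul τ)]
      refine integral_congr_ae (Filter.Eventually.of_forall fun p => ?_)
      dsimp only
      rw [volterraKernel_add_smul]; ring
    rw [e]; ring
  have hdual := hr.integral_terminal_mul hκ hb hρ hρi hd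
  have hrv : Integrable (fun p => deriv σ (ξ p) * r p * controlAction ν T σ a' b' g ξ p) m := by
    refine ((hκ.mul hv).mul_integrable hri).congr (Filter.Eventually.of_forall fun p => ?_)
    dsimp only; ring
  have hrd : Integrable (fun p => r p * (σ (ξ' p) - σ (ξ p))) m := by
    simpa only [mul_comm] using hd.mul_integrable hri
  have hrk : Integrable (fun q => deriv σ (ξ q) * r q *
      ∫ p, volterraKernel b (q, p) * (σ (ξ' p) - σ (ξ p)) ∂m) m := by
    refine ((hκ.mul (hb.volterraKernel.integral_mul (ν := m) hd.meas hd.integrable)).mul_integrable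
      hri).congr (Filter.Eventually.of_forall fun p => ?_)
    dsimp only; ring
  have hmain : (∫ p, ρ p.1 * (σ (ξ' p) - σ (ξ p)) ∂m) -
      τ * ∫ p, deriv σ (ξ p) * r p * controlAction ν T σ a' b' g ξ p ∂m =
      ∫ p, r p * ((σ (ξ' p) - σ (ξ p) - deriv σ (ξ p) * (ξ' p - ξ p)) -
        τ * (deriv σ (ξ p) *
          ∫ q, volterraKernel b' (p, q) * (σ (ξ' q) - σ (ξ q)) ∂m)) ∂m := by
    have hsum : Integrable (fun p => r p * (σ (ξ' p) - σ (ξ p)) + deriv σ (ξ p) * r p *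
      ∫ q, volterraKernel b (p, q) * (σ (ξ' q) - σ (ξ q)) ∂m) m := hrd.add hrk
    rw [hdual, ← integral_const_mul, ← integral_add hrd hrk,
      ← integral_sub hsum (hrv.const_mul τ)]
    refine integral_congr_ae (Filter.Eventually.of_forall fun p => ?_)
    dsimp only
    rw [hinc p]; ring
  rw [hmain, ← Real.norm_eq_abs]
  set B := η / (2 * (C * (I + 1))) * (C * τ) + τ * (D * (M' * (K * C * τ) * V)) with hB
  have hbound : ‖∫ p, r p * ((σ (ξ' p) - σ (ξ p) - deriv σ (ξ p) * (ξ' p - ξ p)) -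
        τ * (deriv σ (ξ p) *
          ∫ q, volterraKernel b' (p, q) * (σ (ξ' q) - σ (ξ q)) ∂m)) ∂m‖ ≤ I * B := by
    rw [hI, ← integral_mul_const]
    refine norm_integral_le_of_norm_le (hri.abs.mul_const B) (Filter.Eventually.of_forall fun p => ?_)
    rw [Real.norm_eq_abs, abs_mul]
    refine mul_le_mul_of_nonneg_left ((abs_sub _ _).trans (add_le_add ?_ ?_)) (abs_nonneg _)
    · have hle : |ξ' p - ξ p| ≤ δ := by
        refine (hξd p).trans ?_
        have := hτ.trans (min_le_left _ _)
        rw [le_div_iff₀ hC0] at this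
        linarith
      exact (hδ _ (hR p) _ hle).trans (mul_le_mul_of_nonneg_left (hξd p) (by positivity))
    · rw [abs_mul, abs_of_pos hτ0, abs_mul]
      exact mul_le_mul_of_nonneg_left
        (mul_le_mul (hD p) (hb'dC p) (abs_nonneg _) hD0.le) hτ0.le
  refine hbound.trans ?_
  have h1 : I * (η / (2 * (C * (I + 1))) * (C * τ)) ≤ η / 2 * τ := by
    have : I * (η / (2 * (C * (I + 1))) * (C * τ)) = η / 2 * τ * (I / (I + 1)) := by
      field_simp
    rw [this]
    exact mul_le_of_le_one_right (by positivity) ((div_le_one (by positivity)).2 (by linarith))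
  have h2 : I * (τ * (D * (M' * (K * C * τ) * V))) ≤ η / 2 * τ := by
    have e : I * (τ * (D * (M' * (K * C * τ) * V))) = τ * (τ * Q) := by rw [hQ]; ring
    have h3 := hτ.trans (min_le_right _ _)
    rw [le_div_iff₀ (by positivity)] at h3
    have : τ * Q ≤ η / 2 := by nlinarith
    rw [e]
    nlinarith
  rw [hB, mul_add]
  linarith

end

end Volterra

/-! ### Curves in `L²` -/

section Curves

variable {E : Type*} [MeasurableSpace E] {ν : Measure E} [IsFiniteMeasure ν] {T : ℝ}

theorem Lp_two_integrable (f : Lp ℝ 2 ν) : Integrable f ν :=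
  (Lp.memLp f).integrable one_le_two

theorem Lp_measurable {p : ℝ≥0∞} {ν : Measure E} (f : Lp ℝ p ν) : Measurable f :=
  (Lp.stronglyMeasurable f).measurable

theorem exists_integral_abs_le_norm (ν : Measure E) [IsFiniteMeasure ν] :
    ∃ B, 0 ≤ B ∧ ∀ f : Lp ℝ 2 ν, ∫ y, |f y| ∂ν ≤ B * ‖f‖ := by
  refine ⟨(ν univ ^ (1 / (1 : ℝ≥0∞).toReal - 1 / (2 : ℝ≥0∞).toReal)).toReal, ENNReal.toReal_nonneg,
    fun f => ?_⟩
  have h1 : ∫ y, |f y| ∂ν = (eLpNorm f 1 ν).toReal := by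
    rw [eLpNorm_one_eq_lintegral_enorm, ← integral_norm_eq_lintegral_enorm
      (Lp.aestronglyMeasurable f)]
    rfl
  rw [h1, Lp.norm_def, ← ENNReal.toReal_mul, mul_comm]
  refine ENNReal.toReal_mono (ENNReal.mul_ne_top (Lp.memLp f).eLpNorm_ne_top ?_)
    (eLpNorm_le_eLpNorm_mul_rpow_measure_univ one_le_two (Lp.aestronglyMeasurable f))
  exact ENNReal.rpow_ne_top_of_nonneg (by norm_num) (measure_ne_top ν univ)

/-- A square-integrable initial state plus the primitive of a bounded function is a continuous
curve in `L²`. -/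
theorem exists_continuousOn_curve (g : Lp ℝ 2 ν) {h : E × ℝ → ℝ} (hh : BddMeas h) :
    ∃ f : ℝ → Lp ℝ 2 ν, ContinuousOn f (Icc 0 T) ∧
      ∀ t, f t =ᵐ[ν] fun y => g y + pastIntegral T h (y, t) := by
  have hP : ∀ t, BddMeas fun y => pastIntegral T h (y, t) := fun t =>
    hh.pastIntegral.comp measurable_prodMk_right
  obtain ⟨C, hC0, hC⟩ := hh.exists_pos
  refine ⟨fun t => g + ((hP t).memLp 2).toLp _, ?_, fun t => ?_⟩
  · refine (continuousOn_const (c := g)).add ?_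
    set B : ℝ := (measureUnivNNReal ν : ℝ) ^ (2 : ℝ≥0∞).toReal⁻¹
    have hB0 : 0 ≤ B := by positivity
    refine LipschitzOnWith.continuousOn (K := (B * C).toNNReal) ?_
    refine LipschitzOnWith.of_dist_le_mul fun t ht s hs => ?_
    rw [Real.coe_toNNReal _ (by positivity), dist_eq_norm, ← MemLp.toLp_sub, Real.dist_eq, mul_assoc]
    refine Lp.norm_le_of_ae_bound (by positivity) ?_
    filter_upwards [MemLp.coeFn_toLp (((hP t).memLp (ν := ν) 2).sub ((hP s).memLp 2))] with y hy
    rw [hy, Pi.sub_apply, pastIntegral_eq_intervalIntegral ht, pastIntegral_eq_intervalIntegral hs]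
    have hii : ∀ u v : ℝ, IntervalIntegrable (fun s => h (y, s)) volume u v := fun u v =>
      ⟨(hh.comp (e := fun s : ℝ => (y, s)) measurable_prodMk_left).integrable,
        (hh.comp (e := fun s : ℝ => (y, s)) measurable_prodMk_left).integrable⟩
    rw [intervalIntegral.integral_interval_sub_left (hii _ _) (hii _ _)]
    exact intervalIntegral.norm_integral_le_of_norm_le_const fun u _ => hC _
  · filter_upwards [Lp.coeFn_add g (((hP t).memLp 2).toLp _),
      MemLp.coeFn_toLp ((hP t).memLp (ν := ν) 2)] with y h1 h2
    rw [h1, Pi.add_apply, h2]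

/-- Pairing a bounded weight with a continuous curve in `L²` gives a jointly measurable function,
although the curve itself comes without a jointly measurable representative. -/
theorem measurable_integral_mul_curve {b : (E × E) × ℝ → ℝ} (hb : BddMeas b) {F : ℝ → Lp ℝ 2 ν}
    (hF : Continuous F) :
    Measurable fun p : E × ℝ => ∫ z, b ((p.1, z), p.2) * F p.2 z ∂ν := by
  -- Freeze the curve on the grid of mesh `1 / (n + 1)`.
  set t : ℕ → ℝ → ℝ := fun n s => ⌊s * (n + 1)⌋ / (n + 1) with ht
  have htlim : ∀ s, Filter.Tendsto (fun n => t n s) Filter.atTop (nhds s) := by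
    intro s
    rw [tendsto_iff_dist_tendsto_zero]
    refine squeeze_zero (fun _ => dist_nonneg) (fun n => ?_)
      (tendsto_one_div_add_atTop_nhds_zero_nat (𝕜 := ℝ))
    have hn : (0 : ℝ) < n + 1 := by positivity
    have h1 := Int.floor_le (s * (n + 1))
    have h2 := Int.lt_floor_add_one (s * (n + 1))
    rw [Real.dist_eq, abs_sub_comm]
    have h3 : s - t n s = (s * (n + 1) - ⌊s * (n + 1)⌋) / (n + 1) := by
      rw [ht]; field_simp
    rw [h3, abs_of_nonneg (div_nonneg (by linarith) hn.le)]
    gcongr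
    linarith
  refine measurable_of_tendsto_metrizable
    (f := fun n (p : E × ℝ) => ∫ z, b ((p.1, z), p.2) * F (t n p.2) z ∂ν) (fun n => ?_)
    (tendsto_pi_nhds.2 fun p => ?_)
  · have hcount : Measurable fun x : (E × ℝ) × ℤ =>
        ∫ z, b ((x.1.1, z), x.1.2) * F ((x.2 : ℝ) / (n + 1)) z ∂ν :=
      measurable_from_prod_countable_left fun k =>
        (hb.integral_weight_mul (ν := ν) (Lp_measurable (F ((k : ℝ) / (n + 1))))
          (Lp_two_integrable _)).meas
    exact hcount.comp (g := fun x : (E × ℝ) × ℤ =>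
        ∫ z, b ((x.1.1, z), x.1.2) * F ((x.2 : ℝ) / (n + 1)) z ∂ν)
      (f := fun p : E × ℝ => (p, ⌊p.2 * (n + 1)⌋))
      (measurable_id.prodMk (Int.measurable_floor.comp (measurable_snd.mul_const _)))
  · obtain ⟨B, hB0, hB⟩ := exists_integral_abs_le_norm ν
    obtain ⟨M, hM0, hM⟩ := hb.exists_pos
    have hbp : BddMeas fun z => b ((p.1, z), p.2) := hb.comp (by fun_prop)
    rw [tendsto_iff_dist_tendsto_zero]
    have hz : Filter.Tendsto (fun n => M * (B * ‖F (t n p.2) - F p.2‖)) Filter.atTop (nhds 0) := by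
      have h1 : Filter.Tendsto (fun n => F (t n p.2) - F p.2) Filter.atTop (nhds 0) := by
        have := ((hF.tendsto p.2).comp (htlim p.2)).sub_const (F p.2)
        simpa using this
      simpa using (h1.norm.const_mul B).const_mul M
    refine squeeze_zero (fun _ => dist_nonneg) (fun n => ?_) hz
    rw [Real.dist_eq, ← integral_sub (hbp.mul_integrable (Lp_two_integrable _))
      (hbp.mul_integrable (Lp_two_integrable _)), ← Real.norm_eq_abs]
    refine le_trans ?_ (mul_le_mul_of_nonneg_left (hB _) hM0.le)
    rw [← integral_const_mul]
    refine norm_integral_le_of_norm_le ((Lp_two_integrable _).abs.const_mul M) ?_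
    filter_upwards [Lp.coeFn_sub (F (t n p.2)) (F p.2)] with z hz
    rw [hz, Pi.sub_apply, ← mul_sub, Real.norm_eq_abs, abs_mul]
    exact mul_le_mul_of_nonneg_right (hM _) (abs_nonneg _)

end Curves

/-! ### The output operator and the quadratic loss -/

section Output

variable {α β : Type*} [MeasurableSpace α] [MeasurableSpace β] {μ₁ : Measure α} {μ₂ : Measure β}

theorem integral_mul_sq_le {f g : α → ℝ} (hf : MemLp f 2 μ₁) (hg : MemLp g 2 μ₁) :
    (∫ x, f x * g x ∂μ₁) ^ 2 ≤ (∫ x, f x ^ 2 ∂μ₁) * ∫ x, g x ^ 2 ∂μ₁ := by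
  have h := abs_real_inner_le_norm (hf.toLp f) (hg.toLp g)
  have e : ∀ {u v : α → ℝ} (hu : MemLp u 2 μ₁) (hv : MemLp v 2 μ₁),
      inner ℝ (hu.toLp u) (hv.toLp v) = ∫ x, u x * v x ∂μ₁ := by
    intro u v hu hv
    rw [L2.inner_def]
    refine integral_congr_ae ?_
    filter_upwards [hu.coeFn_toLp, hv.coeFn_toLp] with x h1 h2
    rw [h1, h2]
    simp [mul_comm]
  have e2 : ∀ {u : α → ℝ} (hu : MemLp u 2 μ₁), ∫ x, u x ^ 2 ∂μ₁ = ‖hu.toLp u‖ ^ 2 := by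
    intro u hu
    rw [← real_inner_self_eq_norm_sq, e hu hu]
    simp only [sq]
  rw [e2 hf, e2 hg, ← e hf hg, ← mul_pow, ← sq_abs]
  gcongr

theorem memLp_two_mul_prod {φ : β → ℝ} {γ : α → ℝ} (hγ : MemLp γ 2 μ₁) (hφ : MemLp φ 2 μ₂) :
    MemLp (fun x : α × β => γ x.1 * φ x.2) 2 (μ₁.prod μ₂) := by
  refine (memLp_two_iff_integrable_sq
    (hγ.1.comp_fst.mul hφ.1.comp_snd)).2 ?_
  refine (hγ.integrable_sq.mul_prod hφ.integrable_sq).congr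
    (Filter.Eventually.of_forall fun x => ?_)
  simp [mul_pow]

variable [SFinite μ₁] [SFinite μ₂] {w : α × β → ℝ} {φ : β → ℝ} {γ : α → ℝ}

theorem ae_memLp_two_prodMk_left (hw : StronglyMeasurable w) (hw2 : MemLp w 2 (μ₁.prod μ₂)) :
    ∀ᵐ u ∂μ₁, MemLp (fun y => w (u, y)) 2 μ₂ := by
  filter_upwards [hw2.integrable_sq.prod_right_ae] with u hu
  exact (memLp_two_iff_integrable_sq
    (hw.comp_measurable measurable_prodMk_left).aestronglyMeasurable).2 hu

/-- A square-integrable kernel defines a bounded operator from `L²(μ₂)` to `L²(μ₁)`. -/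
theorem memLp_integral_kernel_mul (hw : StronglyMeasurable w) (hw2 : MemLp w 2 (μ₁.prod μ₂))
    (hφm : StronglyMeasurable φ) (hφ : MemLp φ 2 μ₂) :
    MemLp (fun u => ∫ y, w (u, y) * φ y ∂μ₂) 2 μ₁ ∧
      ∫ u, (∫ y, w (u, y) * φ y ∂μ₂) ^ 2 ∂μ₁ ≤
        (∫ u, ∫ y, w (u, y) ^ 2 ∂μ₂ ∂μ₁) * ∫ y, φ y ^ 2 ∂μ₂ := by
  have hbound : ∀ᵐ u ∂μ₁, (∫ y, w (u, y) * φ y ∂μ₂) ^ 2 ≤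
      (∫ y, w (u, y) ^ 2 ∂μ₂) * ∫ y, φ y ^ 2 ∂μ₂ := by
    filter_upwards [ae_memLp_two_prodMk_left hw hw2] with u hu
    exact integral_mul_sq_le hu hφ
  have hmeas : StronglyMeasurable fun u => ∫ y, w (u, y) * φ y ∂μ₂ :=
    (hw.mul (hφm.comp_measurable measurable_snd)).integral_prod_right
  have hint : Integrable (fun u => (∫ y, w (u, y) ^ 2 ∂μ₂) * ∫ y, φ y ^ 2 ∂μ₂) μ₁ :=
    hw2.integrable_sq.integral_prod_left.mul_const _
  have hsq : Integrable (fun u => (∫ y, w (u, y) * φ y ∂μ₂) ^ 2) μ₁ := by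
    refine hint.mono' (hmeas.pow 2).aestronglyMeasurable ?_
    filter_upwards [hbound] with u hu
    rwa [Real.norm_of_nonneg (sq_nonneg _)]
  refine ⟨(memLp_two_iff_integrable_sq hmeas.aestronglyMeasurable).2 hsq, ?_⟩
  rw [← integral_mul_const]
  exact integral_mono_ae hsq hint hbound

theorem integral_mul_integral_kernel_comm (hw2 : MemLp w 2 (μ₁.prod μ₂)) (hγ : MemLp γ 2 μ₁)
    (hφ : MemLp φ 2 μ₂) :
    ∫ u, γ u * ∫ y, w (u, y) * φ y ∂μ₂ ∂μ₁ = ∫ y, (∫ u, γ u * w (u, y) ∂μ₁) * φ y ∂μ₂ := by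
  have hint : Integrable (Function.uncurry fun u y => γ u * w (u, y) * φ y) (μ₁.prod μ₂) := by
    refine (hw2.integrable_mul (memLp_two_mul_prod hγ hφ)).congr
      (Filter.Eventually.of_forall fun x => ?_)
    simp only [Function.uncurry, Pi.mul_apply]; ring
  have := integral_integral_swap hint
  simp only [integral_mul_const] at this
  simpa only [mul_assoc, integral_const_mul] using this

end Output

section Loss

variable {l d : ℕ} {U : Set (EuclideanSpace ℝ (Fin l))} {Y : Set (EuclideanSpace ℝ (Fin d))}

/-- The terminal value of the co-state, `W*(W f + μ - P)`. -/
noncomputable def terminalCostate (w : OutputWeightSpace U Y) (μ P : StateSpace U)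
    (f : StateSpace Y) (y : EuclideanSpace ℝ (Fin d)) : ℝ :=
  ∫ u in U, (networkOutput w μ f u - P u) * w (u, y)

variable (w : OutputWeightSpace U Y) (μ P : StateSpace U) (f : StateSpace Y)

theorem memLp_networkOutput_sub : MemLp (fun u => networkOutput w μ f u - P u) 2 (domMeasure U) :=
  ((memLp_integral_kernel_mul (Lp.stronglyMeasurable w) (Lp.memLp w) (Lp.stronglyMeasurable f)
    (Lp.memLp f)).1.add (Lp.memLp μ)).sub (Lp.memLp P)

theorem stronglyMeasurable_networkOutput_sub :
    StronglyMeasurable fun u => networkOutput w μ f u - P u := by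
  have h1 : StronglyMeasurable fun u => ∫ y in Y, w (u, y) * f y :=
    ((Lp.stronglyMeasurable w).mul
      ((Lp.stronglyMeasurable f).comp_measurable measurable_snd)).integral_prod_right
  exact (h1.add (Lp.stronglyMeasurable μ)).sub (Lp.stronglyMeasurable P)

theorem stronglyMeasurable_terminalCostate : StronglyMeasurable (terminalCostate w μ P f) := by
  refine StronglyMeasurable.integral_prod_left
    (f := fun u y => (networkOutput w μ f u - P u) * w (u, y)) ?_
  exact ((stronglyMeasurable_networkOutput_sub w μ P f).comp_measurable measurable_fst).mul
    (Lp.stronglyMeasurable w)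

theorem memLp_terminalCostate : MemLp (terminalCostate w μ P f) 2 (domMeasure Y) := by
  have h := (memLp_integral_kernel_mul (w := fun x => w x.swap)
    ((Lp.stronglyMeasurable w).comp_measurable measurable_swap)
    ((Lp.memLp w).comp_measurePreserving Measure.measurePreserving_swap)
    (stronglyMeasurable_networkOutput_sub w μ P f) (memLp_networkOutput_sub w μ P f)).1
  refine h.congr_norm (stronglyMeasurable_terminalCostate w μ P f).aestronglyMeasurable
    (Filter.Eventually.of_forall fun y => ?_)
  simp only [terminalCostate, Prod.swap_prod_mk, mul_comm]

/-- The loss is a quadratic polynomial of the terminal state, with gradient the terminal value of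
the co-state. -/
theorem integral_abs_networkOutput_sub_sq (φ : StateSpace Y) :
    ∫ u in U, |networkOutput w μ φ u - P u| ^ 2 =
      (∫ u in U, |networkOutput w μ f u - P u| ^ 2) +
        2 * (∫ y in Y, terminalCostate w μ P f y * (φ y - f y)) +
        ∫ u in U, (∫ y in Y, w (u, y) * (φ y - f y)) ^ 2 := by
  have hΔm : StronglyMeasurable fun y => φ y - f y :=
    (Lp.stronglyMeasurable φ).sub (Lp.stronglyMeasurable f)
  have hΔ : MemLp (fun y => φ y - f y) 2 (domMeasure Y) := (Lp.memLp φ).sub (Lp.memLp f)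
  have hW := (memLp_integral_kernel_mul (Lp.stronglyMeasurable w) (Lp.memLp w) hΔm hΔ).1
  have hZ := memLp_networkOutput_sub w μ P f
  have hadd : ∀ᵐ u ∂(domMeasure U), networkOutput w μ φ u - P u =
      (networkOutput w μ f u - P u) + ∫ y in Y, w (u, y) * (φ y - f y) := by
    filter_upwards [ae_memLp_two_prodMk_left (Lp.stronglyMeasurable w) (Lp.memLp w)] with u hu
    simp only [networkOutput, mul_sub]
    have h1 : Integrable (fun y => w (u, y) * φ y) (domMeasure Y) := hu.integrable_mul (Lp.memLp φ)
    have h2 : Integrable (fun y => w (u, y) * f y) (domMeasure Y) := hu.integrable_mul (Lp.memLp f)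
    rw [integral_sub h1 h2]
    ring
  have hcross := integral_mul_integral_kernel_comm (Lp.memLp w) hZ hΔ
  simp only [terminalCostate]
  rw [← hcross, ← integral_const_mul]
  have hi1 : Integrable (fun u => |networkOutput w μ f u - P u| ^ 2) (domMeasure U) := by
    simpa only [sq_abs] using hZ.integrable_sq
  have hi2 : Integrable (fun u => 2 * ((networkOutput w μ f u - P u) *
      ∫ y in Y, w (u, y) * (φ y - f y))) (domMeasure U) := (hZ.integrable_mul hW).const_mul 2
  have hi12 : Integrable (fun u => |networkOutput w μ f u - P u| ^ 2 +
      2 * ((networkOutput w μ f u - P u) * ∫ y in Y, w (u, y) * (φ y - f y))) (domMeasure U) :=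
    hi1.add hi2
  rw [← integral_add hi1 hi2, ← integral_add hi12 hW.integrable_sq]
  refine integral_congr_ae ?_
  filter_upwards [hadd] with u hu
  rw [hu, sq_abs, sq_abs]
  ring

theorem isLeastSquaresSolution_of_terminalCostate_eq_zero
    (h : ∀ᵐ y ∂(domMeasure Y), terminalCostate w μ P f y = 0) :
    IsLeastSquaresSolution w μ P f := by
  refine ⟨h, fun φ => ?_⟩
  rw [integral_abs_networkOutput_sub_sq w μ P f φ]
  have h0 : ∫ y in Y, terminalCostate w μ P f y * (φ y - f y) = 0 := by
    refine integral_eq_zero_of_ae ?_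
    filter_upwards [h] with y hy
    simp [hy]
  have h1 : 0 ≤ ∫ u in U, (∫ y in Y, w (u, y) * (φ y - f y)) ^ 2 :=
    integral_nonneg fun u => sq_nonneg _
  rw [h0]
  linarith

end Loss

/-! ### Null sets of triples and of pairs -/

section NullSets

variable {E : Type*} [MeasurableSpace E] {ν : Measure E} [IsFiniteMeasure ν] {T : ℝ}

theorem measurePreserving_insert (ν : Measure E) [IsFiniteMeasure ν] (T : ℝ) :
    MeasurePreserving (fun x : (E × ℝ) × E => ((x.1.1, x.2), x.1.2))
      ((ν.prod (timeMeasure T)).prod ν) ((ν.prod ν).prod (timeMeasure T)) := by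
  have h1 := measurePreserving_prodAssoc ν (timeMeasure T) ν
  have h2 := (MeasurePreserving.id ν).prod
    (Measure.measurePreserving_swap (μ := timeMeasure T) (ν := ν))
  have h3 := (measurePreserving_prodAssoc ν ν (timeMeasure T)).symm
  exact h3.comp (h2.comp h1)

theorem measurePreserving_remove (ν : Measure E) [IsFiniteMeasure ν] (T : ℝ) :
    MeasurePreserving (fun x : (E × E) × ℝ => ((x.1.1, x.2), x.1.2))
      ((ν.prod ν).prod (timeMeasure T)) ((ν.prod (timeMeasure T)).prod ν) := by
  have h1 := measurePreserving_prodAssoc ν ν (timeMeasure T)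
  have h2 := (MeasurePreserving.id ν).prod
    (Measure.measurePreserving_swap (μ := ν) (ν := timeMeasure T))
  have h3 := (measurePreserving_prodAssoc ν (timeMeasure T) ν).symm
  exact h3.comp (h2.comp h1)

theorem ae_ae_of_ae_weight {P : (E × E) × ℝ → Prop}
    (h : ∀ᵐ x ∂((ν.prod ν).prod (timeMeasure T)), P x) :
    ∀ᵐ p ∂(ν.prod (timeMeasure T)), ∀ᵐ z ∂ν, P ((p.1, z), p.2) :=
  Measure.ae_ae_of_ae_prod ((measurePreserving_insert ν T).quasiMeasurePreserving.ae h)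

theorem ae_ae_of_ae_weight_swap {P : (E × E) × ℝ → Prop}
    (h : ∀ᵐ x ∂((ν.prod ν).prod (timeMeasure T)), P x) :
    ∀ᵐ p ∂(ν.prod (timeMeasure T)), ∀ᵐ z ∂ν, P ((z, p.1), p.2) :=
  ae_ae_of_ae_weight (P := fun x => P (x.1.swap, x.2))
    (((Measure.measurePreserving_swap (μ := ν) (ν := ν)).prod
      (MeasurePreserving.id (timeMeasure T))).quasiMeasurePreserving.ae h)

theorem ae_weight_of_ae_ae {P : (E × E) × ℝ → Prop} (hP : MeasurableSet {x | P x})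
    (h : ∀ᵐ p ∂(ν.prod (timeMeasure T)), ∀ᵐ z ∂ν, P ((p.1, z), p.2)) :
    ∀ᵐ x ∂((ν.prod ν).prod (timeMeasure T)), P x := by
  have hm : MeasurableSet {x : (E × ℝ) × E | P ((x.1.1, x.2), x.1.2)} :=
    hP.preimage (measurePreserving_insert ν T).measurable
  exact (measurePreserving_remove ν T).quasiMeasurePreserving.ae
    ((Measure.ae_prod_mem_iff_ae_ae_mem hm).2 h)

theorem ae_weight_of_ae {Q : E × ℝ → Prop} (h : ∀ᵐ p ∂(ν.prod (timeMeasure T)), Q p) :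
    ∀ᵐ x ∂((ν.prod ν).prod (timeMeasure T)), Q (x.1.1, x.2) :=
  (measurePreserving_remove ν T).quasiMeasurePreserving.ae
    (Measure.quasiMeasurePreserving_fst.ae h)

theorem ae_ae_time {Q : E × ℝ → Prop} (h : ∀ᵐ p ∂(ν.prod (timeMeasure T)), Q p) :
    ∀ᵐ s ∂(timeMeasure T), ∀ᵐ y ∂ν, Q (y, s) :=
  Measure.ae_ae_of_ae_prod (p := fun x : ℝ × E => Q x.swap)
    (Measure.measurePreserving_swap.quasiMeasurePreserving.ae h)

theorem ae_time_mem (ν : Measure E) [IsFiniteMeasure ν] (T : ℝ) :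
    ∀ᵐ p ∂(ν.prod (timeMeasure T)), p.2 ∈ Ioo 0 T :=
  Measure.quasiMeasurePreserving_snd.ae (ae_restrict_mem measurableSet_Ioo)

theorem exists_bddMeas_rep {α : Type*} [MeasurableSpace α] {m : Measure α} (f : Lp ℝ ∞ m) :
    ∃ a, BddMeas a ∧ f =ᵐ[m] a := by
  have hC : ∀ᵐ x ∂m, ‖f x‖ ≤ ‖f‖ := by
    filter_upwards [ae_le_eLpNormEssSup (f := f) (μ := m)] with x hx
    rw [Lp.norm_def, eLpNorm_exponent_top, ← toReal_enorm]
    refine ENNReal.toReal_mono ?_ hx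
    rw [← eLpNorm_exponent_top]
    exact Lp.eLpNorm_ne_top f
  refine ⟨fun x => max (-‖f‖) (min ‖f‖ (f x)),
    ⟨measurable_const.max (measurable_const.min (Lp_measurable f)), ‖f‖, fun x => ?_⟩, ?_⟩
  · exact abs_le.2 ⟨le_max_left _ _, max_le (by linarith [norm_nonneg f]) (min_le_left _ _)⟩
  · filter_upwards [hC] with x hx
    have := abs_le.1 hx
    rw [min_eq_right this.2, max_eq_right this.1]

end NullSets

/-! ### Solutions of the forward problem and preactivations -/

section Forward

variable {d : ℕ} {Y : Set (EuclideanSpace ℝ (Fin d))} [IsFiniteMeasure (domMeasure Y)] {T : ℝ}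
  {σ : ℝ → ℝ} {c : BiasSpace Y T × WeightSpace Y T} {a : EuclideanSpace ℝ (Fin d) × ℝ → ℝ}
  {b : (EuclideanSpace ℝ (Fin d) × EuclideanSpace ℝ (Fin d)) × ℝ → ℝ} {fI : StateSpace Y}
  {ξ : EuclideanSpace ℝ (Fin d) × ℝ → ℝ} {F : ℝ → StateSpace Y}

/-- `F` is the trajectory in `L²(Y)` of the state with preactivation `ξ`. -/
structure IsTrajectory (σ : ℝ → ℝ) (c : BiasSpace Y T × WeightSpace Y T) (fI : StateSpace Y)
    (ξ : EuclideanSpace ℝ (Fin d) × ℝ → ℝ) (F : ℝ → StateSpace Y) : Prop where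
  state : ∀ t ∈ Icc 0 T, F t =ᵐ[domMeasure Y] fun y => stateOf T σ fI ξ (y, t)
  preactivation_ae : ∀ᵐ p ∂((domMeasure Y).prod (timeMeasure T)),
    preactivation c (F p.2) p.1 p.2 = ξ p

theorem pastIntegral_congr {E : Type*} {h h' : E × ℝ → ℝ} {y : E}
    (hh : ∀ᵐ s ∂(timeMeasure T), h (y, s) = h' (y, s)) (t : ℝ) :
    pastIntegral T h (y, t) = pastIntegral T h' (y, t) := by
  refine integral_congr_ae ?_
  filter_upwards [hh] with s hs
  simp only [hs]

theorem preactivation_ae_eq (ha : c.1 =ᵐ[(domMeasure Y).prod (timeMeasure T)] a)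
    (hb : c.2 =ᵐ[((domMeasure Y).prod (domMeasure Y)).prod (timeMeasure T)] b) :
    ∀ᵐ p ∂((domMeasure Y).prod (timeMeasure T)), ∀ f : StateSpace Y,
      preactivation c f p.1 p.2 = a p - ∫ z in Y, b ((p.1, z), p.2) * f z := by
  filter_upwards [ha, ae_ae_of_ae_weight hb] with p h1 h2 f
  rw [preactivation]
  congr 1
  refine integral_congr_ae ?_
  filter_upwards [h2] with z hz
  rw [hz]

/-- A solution of the forward problem is the trajectory of a bounded preactivation that is defined
and measurable everywhere. -/
theorem IsForwardSolution.exists_isPreactivation (hT : 0 ≤ T) (hσ : Continuous σ) (ha : BddMeas a)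
    (hb : BddMeas b) (hca : c.1 =ᵐ[(domMeasure Y).prod (timeMeasure T)] a)
    (hcb : c.2 =ᵐ[((domMeasure Y).prod (domMeasure Y)).prod (timeMeasure T)] b)
    (hF : IsForwardSolution σ c fI F) :
    ∃ ξ, IsPreactivation (domMeasure Y) T σ a b fI ξ ∧ IsTrajectory σ c fI ξ F := by
  have hgi := Lp_two_integrable fI
  have hg := Lp_measurable fI
  set F' : ℝ → StateSpace Y := fun s => F (clampTime T s)
  have hF'c : Continuous F' := hF.1.comp_continuous (continuous_clampTime T) fun s =>
    ⟨clampTime_nonneg hT s, clampTime_le T s⟩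
  have hF'e : ∀ s ∈ Icc 0 T, F' s = F s := fun s hs => by
    change F (clampTime T s) = F s
    rw [clampTime_of_mem hs]
  obtain ⟨R, hR⟩ := isCompact_Icc.exists_bound_of_continuousOn hF.1
  obtain ⟨B, hB0, hB⟩ := exists_integral_abs_le_norm (domMeasure Y)
  obtain ⟨M, hM0, hM⟩ := hb.exists_pos
  set ξ₁ : EuclideanSpace ℝ (Fin d) × ℝ → ℝ :=
    fun p => a p - ∫ z in Y, b ((p.1, z), p.2) * F' p.2 z
  have hξ₁b : BddMeas ξ₁ := by
    refine ha.sub ⟨measurable_integral_mul_curve hb hF'c, M * (B * R), fun p => ?_⟩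
    rw [← Real.norm_eq_abs]
    have h1 : ‖∫ z in Y, b ((p.1, z), p.2) * F' p.2 z‖ ≤ M * ∫ z in Y, |F' p.2 z| := by
      rw [← integral_const_mul]
      refine norm_integral_le_of_norm_le ((Lp_two_integrable _).abs.const_mul M)
        (Filter.Eventually.of_forall fun z => ?_)
      rw [Real.norm_eq_abs, abs_mul]
      exact mul_le_mul_of_nonneg_right (hM _) (abs_nonneg _)
    refine h1.trans (mul_le_mul_of_nonneg_left ((hB _).trans
      (mul_le_mul_of_nonneg_left ?_ hB0)) hM0.le)
    exact hR _ ⟨clampTime_nonneg hT _, clampTime_le T _⟩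
  have hpre : ∀ᵐ p ∂((domMeasure Y).prod (timeMeasure T)),
      preactivation c (F p.2) p.1 p.2 = ξ₁ p := by
    filter_upwards [preactivation_ae_eq hca hcb, ae_time_mem (domMeasure Y) T] with p h1 h2
    rw [h1, ← hF'e _ (Ioo_subset_Icc_self h2)]
  have hstate : ∀ t ∈ Icc 0 T, F t =ᵐ[domMeasure Y] fun y => stateOf T σ fI ξ₁ (y, t) := by
    intro t ht
    filter_upwards [hF.2 t ht, Measure.ae_ae_of_ae_prod hpre] with y h1 h2
    rw [h1, ← pastIntegral_eq_intervalIntegral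
      (h := fun q => σ (preactivation c (F q.2) q.1 q.2)) ht, stateOf]
    congr 1
    refine pastIntegral_congr ?_ t
    filter_upwards [h2] with s hs
    rw [hs]
  have hξ₁e : ∀ p : EuclideanSpace ℝ (Fin d) × ℝ, p.2 ∈ Ioo 0 T →
      ξ₁ p = controlAction (domMeasure Y) T σ a b fI ξ₁ p := by
    intro p hp
    change a p - ∫ z in Y, b ((p.1, z), p.2) * F' p.2 z = a p - _
    congr 1
    refine integral_congr_ae ?_
    filter_upwards [hstate p.2 (Ioo_subset_Icc_self hp)] with z hz
    rw [hF'e _ (Ioo_subset_Icc_self hp), hz]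
  -- The Volterra equation, so far known on `(0, T)` only, is used to redefine `ξ₁` elsewhere.
  set ξ : EuclideanSpace ℝ (Fin d) × ℝ → ℝ :=
    controlAction (domMeasure Y) T σ a b fI ξ₁ with hξ
  have hξb : BddMeas ξ := BddMeas.controlAction hσ ha hb hg hgi hξ₁b
  have hst : stateOf T σ fI ξ = stateOf T σ fI ξ₁ := by
    funext p
    simp only [stateOf]
    congr 1
    refine pastIntegral_congr (y := p.1) ?_ p.2
    filter_upwards [ae_restrict_mem measurableSet_Ioo] with s hs
    rw [hξ₁e (p.1, s) hs]
  refine ⟨ξ, ⟨hξb, fun p => ?_⟩, fun t ht => ?_, ?_⟩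
  · rw [← controlAction_eq hσ hb hgi hξb p]
    conv_lhs => rw [hξ]
    simp only [controlAction, hst]
  · rw [hst]
    exact hstate t ht
  · filter_upwards [hpre, ae_time_mem (domMeasure Y) T] with p h1 h2
    rw [h1, hξ₁e p h2]

theorem IsPreactivation.exists_isForwardSolution (hσ : Continuous σ)
    (hb : BddMeas b) (hca : c.1 =ᵐ[(domMeasure Y).prod (timeMeasure T)] a)
    (hcb : c.2 =ᵐ[((domMeasure Y).prod (domMeasure Y)).prod (timeMeasure T)] b)
    (hξ : IsPreactivation (domMeasure Y) T σ a b fI ξ) :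
    ∃ F, IsForwardSolution σ c fI F ∧ IsTrajectory σ c fI ξ F := by
  obtain ⟨F, hFc, hF⟩ := exists_continuousOn_curve (T := T) fI (hξ.bddMeas.continuous_comp hσ)
  have hpre : ∀ᵐ p ∂((domMeasure Y).prod (timeMeasure T)),
      preactivation c (F p.2) p.1 p.2 = ξ p := by
    filter_upwards [preactivation_ae_eq hca hcb] with p h1
    rw [h1, hξ.eq_controlAction hσ hb (Lp_two_integrable fI), controlAction]
    congr 1
    refine integral_congr_ae ?_
    filter_upwards [hF p.2] with z hz
    rw [hz, stateOf]
  refine ⟨F, ⟨hFc, fun t ht => ?_⟩, fun t _ => hF t, hpre⟩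
  filter_upwards [hF t, Measure.ae_ae_of_ae_prod hpre] with y h1 h2
  rw [h1, ← pastIntegral_eq_intervalIntegral
    (h := fun q => σ (preactivation c (F q.2) q.1 q.2)) ht]
  congr 1
  refine pastIntegral_congr ?_ t
  filter_upwards [h2] with s hs
  rw [hs]

/-! ### Co-states -/

theorem integral_time_ite_eq_intervalIntegral (h : ℝ → ℝ) {t : ℝ} (ht : t ∈ Icc 0 T) :
    ∫ s, (if t < s then h s else 0) ∂(timeMeasure T) = ∫ s in t..T, h s := by
  have h1 : ∫ s, (if t < s then h s else 0) ∂(timeMeasure T) =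
      ∫ s in Ioo 0 T, (Ioi t).indicator h s := by
    simp only [indicator, mem_Ioi]
  have h2 : Ioo 0 T ∩ Ioi t = Ioo t T := by
    ext s
    simp only [mem_inter_iff, mem_Ioo, mem_Ioi]
    exact ⟨fun h => ⟨h.2, h.1.2⟩, fun h => ⟨⟨ht.1.trans_lt h.1, h.2⟩, h.1⟩⟩
  rw [h1, setIntegral_indicator measurableSet_Ioi, h2, intervalIntegral.integral_of_le ht.2,
    integral_Ioc_eq_integral_Ioo]

section

variable {E : Type*} [MeasurableSpace E] {ν : Measure E} [IsFiniteMeasure ν]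
  {β : (E × E) × ℝ → ℝ} {κ : E × ℝ → ℝ} {ρ : E → ℝ} {r : E × ℝ → ℝ}

theorem IsAdjoint.bddMeas_rate (hβ : BddMeas β) (hκ : BddMeas κ) (hρ : Measurable ρ)
    (hρi : Integrable ρ ν) (hr : IsAdjoint ν T β κ ρ r) :
    BddMeas fun p : E × ℝ => ∫ z, β ((z, p.1), p.2) * (κ (z, p.2) * r (z, p.2)) ∂ν := by
  have hk : BddMeas fun x : (E × ℝ) × E => β ((x.2, x.1.1), x.1.2) * κ (x.2, x.1.2) :=
    (hβ.comp (by fun_prop)).mul (hκ.comp (e := fun x : (E × ℝ) × E => (x.2, x.1.2)) (by fun_prop))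
  have hx : BddMeas fun x : (E × ℝ) × E => r (x.2, x.1.2) - ρ x.2 :=
    hr.bddMeas.comp (e := fun x : (E × ℝ) × E => (x.2, x.1.2)) (by fun_prop)
  have hsum := (hk.integral_mul hρ hρi).add ((hk.mul hx).integral_right (ν := ν))
  convert hsum using 1
  funext p
  have hkp : BddMeas fun z => β ((z, p.1), p.2) * κ (z, p.2) := hk.comp measurable_prodMk_left
  have hxp : BddMeas fun z => r (z, p.2) - ρ z :=
    hx.comp (e := fun z : E => (p, z)) measurable_prodMk_left
  rw [← integral_add (hkp.mul_integrable hρi) (hkp.mul hxp).integrable]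
  exact integral_congr_ae (Filter.Eventually.of_forall fun z => by ring)

theorem IsAdjoint.eq_sub_integral (hβ : BddMeas β) (hκ : BddMeas κ)
    (hρi : Integrable ρ ν) (hr : IsAdjoint ν T β κ ρ r) {t : ℝ} (ht : t ∈ Icc 0 T) (y : E) :
    r (y, t) = ρ y - ∫ s in t..T, ∫ z, β ((z, y), s) * (κ (z, s) * r (z, s)) ∂ν := by
  have hint : Integrable (fun q => volterraKernel β (q, (y, t)) * (κ q * r q))
      (ν.prod (timeMeasure T)) :=
    (hβ.volterraKernel.comp measurable_prodMk_right).mul_integrable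
      (hκ.mul_integrable (hr.integrable hρi))
  rw [hr.eq (y, t), integral_prod_symm _ hint, ← integral_time_ite_eq_intervalIntegral _ ht]
  congr 1
  refine integral_congr_ae (Filter.Eventually.of_forall fun s => ?_)
  simp only [volterraKernel]
  split_ifs <;> simp

end

/-- A bounded solution of the adjoint Volterra equation yields a co-state. -/
theorem IsTrajectory.exists_isCostate {l : ℕ} {U : Set (EuclideanSpace ℝ (Fin l))} (hT : 0 ≤ T)
    (hσ' : Continuous (deriv σ))
    (hb : BddMeas b)
    (hcb : c.2 =ᵐ[((domMeasure Y).prod (domMeasure Y)).prod (timeMeasure T)] b)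
    (w : OutputWeightSpace U Y) (μ P : StateSpace U) (hξ : BddMeas ξ)
    (hF : IsTrajectory σ c fI ξ F) {r : EuclideanSpace ℝ (Fin d) × ℝ → ℝ}
    (hr : IsAdjoint (domMeasure Y) T b (fun q => deriv σ (ξ q)) (terminalCostate w μ P (F T)) r) :
    ∃ R, IsCostate σ (fun x => x) w μ P c F R ∧
      ∀ t ∈ Icc 0 T, R t =ᵐ[domMeasure Y] fun y => r (y, t) := by
  set ρ := terminalCostate w μ P (F T) with hρdef
  have hρ : Measurable ρ := (stronglyMeasurable_terminalCostate w μ P (F T)).measurable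
  have hρ2 : MemLp ρ 2 (domMeasure Y) := memLp_terminalCostate w μ P (F T)
  have hρi : Integrable ρ (domMeasure Y) := hρ2.integrable one_le_two
  have hκ : BddMeas fun q => deriv σ (ξ q) := hξ.continuous_comp hσ'
  have he := hr.bddMeas_rate hb hκ hρ hρi
  set e : EuclideanSpace ℝ (Fin d) × ℝ → ℝ := fun p =>
    ∫ z in Y, b ((z, p.1), p.2) * (deriv σ (ξ (z, p.2)) * r (z, p.2)) with hedef
  have hreq : ∀ t ∈ Icc 0 T, ∀ y, r (y, t) = ρ y - ∫ s in t..T, e (y, s) := fun t ht y =>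
    hr.eq_sub_integral hb hκ hρi ht y
  have hg : MemLp (fun y => ρ y - pastIntegral T e (y, T)) 2 (domMeasure Y) :=
    hρ2.sub ((he.pastIntegral.comp measurable_prodMk_right).memLp 2)
  obtain ⟨R, hRc, hR⟩ := exists_continuousOn_curve (T := T) (hg.toLp _) he
  have hRr : ∀ t ∈ Icc 0 T, R t =ᵐ[domMeasure Y] fun y => r (y, t) := by
    intro t ht
    filter_upwards [hR t, hg.coeFn_toLp] with y h1 h2
    have hii : ∀ u v : ℝ, IntervalIntegrable (fun s => e (y, s)) volume u v := fun u v =>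
      ⟨(he.comp (e := fun s : ℝ => (y, s)) measurable_prodMk_left).integrable,
        (he.comp (e := fun s : ℝ => (y, s)) measurable_prodMk_left).integrable⟩
    rw [h1, h2, hreq t ht y, pastIntegral_eq_intervalIntegral ht,
      pastIntegral_eq_intervalIntegral (right_mem_Icc.2 hT),
      ← intervalIntegral.integral_add_adjacent_intervals (hii 0 t) (hii t T)]
    ring
  refine ⟨R, ⟨hRc, fun t ht => ?_⟩, hRr⟩
  -- On almost every line the integrand of the co-state equation is `e`.
  have hrate : ∀ᵐ p ∂((domMeasure Y).prod (timeMeasure T)),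
      ∫ z in Y, c.2 ((z, p.1), p.2) *
        (deriv σ (preactivation c (F p.2) z p.2) * R p.2 z) = e p := by
    have h1 := ae_ae_of_ae_weight_swap hcb
    have h2 := (Measure.quasiMeasurePreserving_snd (μ := domMeasure Y)).ae
      (ae_ae_time hF.preactivation_ae)
    filter_upwards [h1, h2, ae_time_mem (domMeasure Y) T] with p k1 k2 k3
    refine integral_congr_ae ?_
    filter_upwards [k1, k2, hRr p.2 (Ioo_subset_Icc_self k3)] with z m1 m2 m3
    rw [m1, m2, m3]
  filter_upwards [hRr t ht, Measure.ae_ae_of_ae_prod hrate] with y h1 h2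
  rw [h1, hreq t ht y]
  congr 1
  · simp [hρdef, terminalCostate]
  · rw [← integral_time_ite_eq_intervalIntegral _ ht, ← integral_time_ite_eq_intervalIntegral _ ht]
    refine integral_congr_ae ?_
    filter_upwards [h2] with s hs
    rw [hs]

end Forward

/-! ### Unique continuation for the adjoint equation -/

section Uniqueness

variable {E : Type*} [MeasurableSpace E] {ν : Measure E} [IsFiniteMeasure ν] {T : ℝ}
  {b : (E × E) × ℝ → ℝ} {κ : E × ℝ → ℝ} {ρ : E → ℝ} {r : E × ℝ → ℝ}

/-- The adjoint equation is linear and can be solved forwards in time as well, so a solution that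
vanishes on an initial time interval vanishes at the terminal time. -/
theorem IsAdjoint.terminal_eq_zero_of_initial_eq_zero (hT : 0 < T) (hκ : BddMeas κ)
    (hb : BddMeas b) (hρ : Measurable ρ) (hρi : Integrable ρ ν) (hr : IsAdjoint ν T b κ ρ r)
    {ε : ℝ} (hε : 0 < ε) (hεT : ε ≤ T)
    (h0 : ∀ᵐ p ∂(ν.prod (timeMeasure T)), p.2 < ε → r p = 0) : ∀ᵐ y ∂ν, ρ y = 0 := by
  have he := hr.bddMeas_rate hb hκ hρ hρi
  set e : E × ℝ → ℝ := fun p => ∫ z, b ((z, p.1), p.2) * (κ (z, p.2) * r (z, p.2)) ∂ν with hedef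
  set x := pastIntegral T e with hx
  have hxb : BddMeas x := he.pastIntegral
  have h0t : ∀ᵐ s ∂(timeMeasure T), s < ε → ∀ᵐ y ∂ν, r (y, s) = 0 := by
    filter_upwards [ae_ae_time h0] with s hs hsε
    filter_upwards [hs] with y hy using hy hsε
  have he0 : ∀ᵐ s ∂(timeMeasure T), s < ε → ∀ y, e (y, s) = 0 := by
    filter_upwards [h0t] with s hs hsε y
    refine integral_eq_zero_of_ae ?_
    filter_upwards [hs hsε] with z hz
    simp [hz]
  have hreq : ∀ t ∈ Icc 0 T, ∀ y, r (y, t) = ρ y - x (y, T) + x (y, t) := by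
    intro t ht y
    have hii : ∀ u v : ℝ, IntervalIntegrable (fun s => e (y, s)) volume u v := fun u v =>
      ⟨(he.comp (e := fun s : ℝ => (y, s)) measurable_prodMk_left).integrable,
        (he.comp (e := fun s : ℝ => (y, s)) measurable_prodMk_left).integrable⟩
    rw [hr.eq_sub_integral hb hκ hρi ht y, hx, pastIntegral_eq_intervalIntegral ht,
      pastIntegral_eq_intervalIntegral (right_mem_Icc.2 hT.le),
      ← intervalIntegral.integral_add_adjacent_intervals (hii 0 t) (hii t T)]
    ring
  obtain ⟨t₀, ht₀, hr₀⟩ : ∃ t₀ ∈ Ioo 0 ε, ∀ᵐ y ∂ν, r (y, t₀) = 0 := by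
    have h1 : ∀ᵐ s ∂(volume.restrict (Ioo 0 ε)), s ∈ Ioo 0 ε ∧ ∀ᵐ y ∂ν, r (y, s) = 0 := by
      filter_upwards [ae_restrict_mem measurableSet_Ioo,
        ae_restrict_of_ae_restrict_of_subset (Ioo_subset_Ioo_right hεT) h0t] with s hs h
      exact ⟨hs, h hs.2⟩
    have : NeZero (volume.restrict (Ioo (0 : ℝ) ε)) :=
      ⟨by simp [Measure.restrict_eq_zero, hε]⟩
    obtain ⟨t₀, h2⟩ := h1.exists
    exact ⟨t₀, h2.1, h2.2⟩
  have hx₀ : ∀ y, x (y, t₀) = 0 := by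
    intro y
    refine integral_eq_zero_of_ae ?_
    filter_upwards [he0] with s hs
    simp only [Pi.zero_apply]
    split_ifs with h
    · exact hs (h.trans ht₀.2) y
    · rfl
  have hρx : ∀ᵐ y ∂ν, ρ y = x (y, T) := by
    filter_upwards [hr₀] with y hy
    rw [hreq t₀ ⟨ht₀.1.le, ht₀.2.le.trans hεT⟩ y, hx₀] at hy
    linarith
  have hrx : ∀ᵐ q ∂(ν.prod (timeMeasure T)), r q = x q := by
    filter_upwards [Measure.quasiMeasurePreserving_fst.ae hρx, ae_time_mem ν T] with q h1 h2
    have := hreq q.2 (Ioo_subset_Icc_self h2) q.1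
    simp only [Prod.mk.eta] at this
    rw [this, h1]; ring
  -- Thus `x` solves a homogeneous forward Volterra equation.
  obtain ⟨M, hM0, hM⟩ := hb.exists_pos
  obtain ⟨K, hK0, hK⟩ := hκ.exists_pos
  obtain ⟨θ, δ, hθ, hθ1, hδ, hk⟩ := exists_forward_weight ν hT.le hM0.le hK0.le
  obtain ⟨C, hC⟩ := hxb.bdd
  have hMb : BddMeas fun _ : (E × E) × ℝ => M := BddMeas.const M
  have hx0 : ∀ p, |x p| ≤ 2 * 0 * θ p := by
    refine abs_le_two_mul_of_forall_half hθ1 le_rfl hC fun S hS hSb p => ?_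
    have hkp : BddMeas fun q : E × ℝ => if q.2 < p.2 then b ((q.1, p.1), q.2) else 0 :=
      BddMeas.ite (measurableSet_lt (by fun_prop) (by fun_prop)) (hb.comp (by fun_prop))
        (BddMeas.const 0)
    have hxp : x p = ∫ q, (if q.2 < p.2 then b ((q.1, p.1), q.2) else 0) * (κ q * r q)
        ∂(ν.prod (timeMeasure T)) := by
      rw [integral_prod_symm _ (hkp.mul_integrable (hκ.mul_integrable (hr.integrable hρi)))]
      refine integral_congr_ae (Filter.Eventually.of_forall fun s => ?_)
      dsimp only
      split_ifs <;> simp [hedef]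
    have hvb : BddMeas fun q : E × ℝ => volterraKernel (fun _ => M) (p, q) :=
      hMb.volterraKernel.comp measurable_prodMk_left
    have hvb' : BddMeas fun q : E × ℝ => |volterraKernel (fun _ => M) (p, q)| * θ q :=
      (hvb.continuous_comp continuous_abs).mul hθ
    calc |x p| ≤ ∫ q, (K * S) * (|volterraKernel (fun _ => M) (p, q)| * θ q)
          ∂(ν.prod (timeMeasure T)) := by
          rw [hxp, ← Real.norm_eq_abs]
          refine norm_integral_le_of_norm_le (hvb'.const_mul _).integrable ?_
          filter_upwards [hrx] with q hq
          rw [hq, Real.norm_eq_abs, abs_mul, abs_mul]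
          have h1 : |if q.2 < p.2 then b ((q.1, p.1), q.2) else 0| ≤
              |volterraKernel (fun _ => M) (p, q)| := by
            simp only [volterraKernel]
            split_ifs
            · rw [abs_of_pos hM0]; exact hM _
            · exact le_rfl
          calc _ ≤ |volterraKernel (fun _ => M) (p, q)| * (K * (S * θ q)) :=
                mul_le_mul h1 (mul_le_mul (hK q) (hSb q) (abs_nonneg _) hK0.le) (by positivity)
                  (abs_nonneg _)
            _ = _ := by ring
      _ = (K * S) * ∫ q, |volterraKernel (fun _ => M) (p, q)| * θ q ∂(ν.prod (timeMeasure T)) :=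
          integral_const_mul _ _
      _ ≤ (K * S) * (δ * θ p) := mul_le_mul_of_nonneg_left
          (hk _ hMb (fun _ => (abs_of_pos hM0).le) p) (by positivity)
      _ = (K * δ) * (S * θ p) := by ring
      _ ≤ 1 / 2 * (S * θ p) :=
          mul_le_mul_of_nonneg_right hδ (mul_nonneg hS (zero_le_one.trans (hθ1 p)))
      _ = (S / 2 + 0) * θ p := by ring
  filter_upwards [hρx] with y hy
  have := hx0 (y, T)
  rw [mul_zero, zero_mul] at this
  rw [hy]
  exact abs_eq_zero.1 (le_antisymm this (abs_nonneg _))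

end Uniqueness

/-! ### The first-order condition -/

section FirstOrder

variable {l d N : ℕ} {U : Set (EuclideanSpace ℝ (Fin l))} {Y : Set (EuclideanSpace ℝ (Fin d))}
  [IsFiniteMeasure (domMeasure Y)] {T : ℝ} {σ : ℝ → ℝ} {c : BiasSpace Y T × WeightSpace Y T}
  {a a' : EuclideanSpace ℝ (Fin d) × ℝ → ℝ}
  {b b' : (EuclideanSpace ℝ (Fin d) × EuclideanSpace ℝ (Fin d)) × ℝ → ℝ}

/-- The one-sided derivative of the loss of one datum in the direction `(a', b')`. -/
theorem IsPreactivation.eventually_loss_le {K : NNReal} (hσL : LipschitzWith K σ)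
    (hσ1 : ContDiff ℝ 1 σ) (hT : 0 ≤ T) (ha' : BddMeas a') (hb : BddMeas b) (hb' : BddMeas b')
    {fI : StateSpace Y} {ξ : EuclideanSpace ℝ (Fin d) × ℝ → ℝ} {F : ℝ → StateSpace Y}
    (hξ : IsPreactivation (domMeasure Y) T σ a b fI ξ) (hF : IsTrajectory σ c fI ξ F)
    (w : OutputWeightSpace U Y) (μ P : StateSpace U) {r : EuclideanSpace ℝ (Fin d) × ℝ → ℝ}
    (hr : IsAdjoint (domMeasure Y) T b (fun q => deriv σ (ξ q)) (terminalCostate w μ P (F T)) r)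
    {η : ℝ} (hη : 0 < η) :
    ∀ᶠ τ in nhdsWithin (0 : ℝ) (Ioi 0), ∀ (c' : BiasSpace Y T × WeightSpace Y T) ξ' F',
      IsPreactivation (domMeasure Y) T σ (fun p => a p + τ * a' p) (fun x => b x + τ * b' x) fI ξ' →
      IsTrajectory σ c' fI ξ' F' →
        ∫ u in U, |networkOutput w μ (F' T) u - P u| ^ 2 ≤
          (∫ u in U, |networkOutput w μ (F T) u - P u| ^ 2) +
            τ * (2 * (∫ p, deriv σ (ξ p) * r p * controlAction (domMeasure Y) T σ a' b' fI ξ p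
              ∂((domMeasure Y).prod (timeMeasure T))) + η) := by
  have hσ := hσL.continuous
  have hgi := Lp_two_integrable fI
  have hg := Lp_measurable fI
  have hρm : Measurable (terminalCostate w μ P (F T)) :=
    (stronglyMeasurable_terminalCostate w μ P (F T)).measurable
  have hρi : Integrable (terminalCostate w μ P (F T)) (domMeasure Y) :=
    (memLp_terminalCostate w μ P (F T)).integrable one_le_two
  obtain ⟨τ₀, hτ₀, hvar⟩ := hr.exists_abs_variation_sub_le hσL hσ1 hT ha' hb hb' hg hgi hξ
    hρm hρi (η := η / 4) (by positivity)
  obtain ⟨C, hC0, hC⟩ := hξ.exists_abs_sub_le hσL hT ha' hb hb' hg hgi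
  -- `Q * τ ^ 2` bounds the quadratic term of the loss.
  set Wn := ∫ u in U, ∫ y in Y, w (u, y) ^ 2
  have hWn0 : 0 ≤ Wn := integral_nonneg fun u => integral_nonneg fun y => sq_nonneg _
  set V := (domMeasure Y).real univ
  have hV0 : 0 ≤ V := measureReal_nonneg
  set L := K * C * (timeMeasure T).real univ with hL
  set Q := Wn * (L ^ 2 * V) with hQ
  have hQ0 : 0 ≤ Q := by positivity
  have hmem : Ioc (0 : ℝ) (min τ₀ (min 1 (η / (2 * (Q + 1))))) ∈ nhdsWithin (0 : ℝ) (Ioi 0) :=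
    Ioc_mem_nhdsGT (by positivity)
  filter_upwards [hmem] with τ hτ c' ξ' F' hξ' hF'
  have hτ0 : 0 < τ := hτ.1
  have hτ1 : τ ≤ 1 := hτ.2.trans ((min_le_right _ _).trans (min_le_left _ _))
  have hτ2 : τ ≤ η / (2 * (Q + 1)) := hτ.2.trans ((min_le_right _ _).trans (min_le_right _ _))
  have hv := hvar τ hτ0 (hτ.2.trans (min_le_left _ _)) hτ1 ξ' hξ'
  have hξd : ∀ p, |ξ' p - ξ p| ≤ C * τ := hC τ ⟨hτ0.le, hτ1⟩ ξ' hξ'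
  have hd : BddMeas fun p => σ (ξ' p) - σ (ξ p) :=
    (hξ'.bddMeas.continuous_comp hσ).sub (hξ.bddMeas.continuous_comp hσ)
  have hdC : ∀ p, |σ (ξ' p) - σ (ξ p)| ≤ K * C * τ := fun p => by
    refine (lipschitz_abs hσL _ _).trans ?_
    rw [mul_assoc]
    exact mul_le_mul_of_nonneg_left (hξd p) K.coe_nonneg
  have hΔ : ∀ᵐ y ∂(domMeasure Y), F' T y - F T y =
      pastIntegral T (fun p => σ (ξ' p) - σ (ξ p)) (y, T) := by
    filter_upwards [hF.state T ⟨hT, le_rfl⟩, hF'.state T ⟨hT, le_rfl⟩] with y h1 h2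
    rw [h1, h2, stateOf, stateOf, pastIntegral_terminal, pastIntegral_terminal,
      pastIntegral_terminal, integral_sub
        ((hξ'.bddMeas.continuous_comp hσ).comp measurable_prodMk_left).integrable
        ((hξ.bddMeas.continuous_comp hσ).comp measurable_prodMk_left).integrable]
    ring
  have hΔC : ∀ᵐ y ∂(domMeasure Y), |F' T y - F T y| ≤ L * τ := by
    filter_upwards [hΔ] with y hy
    rw [hy, pastIntegral_terminal, ← Real.norm_eq_abs]
    refine (norm_integral_le_of_norm_le_const
      (Filter.Eventually.of_forall fun s => hdC (y, s))).trans (le_of_eq ?_)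
    rw [hL]; ring
  have hlin : ∫ y in Y, terminalCostate w μ P (F T) y * (F' T y - F T y) =
      ∫ p, terminalCostate w μ P (F T) p.1 * (σ (ξ' p) - σ (ξ p))
        ∂((domMeasure Y).prod (timeMeasure T)) := by
    rw [← integral_mul_pastIntegral_terminal hρi hd]
    refine integral_congr_ae ?_
    filter_upwards [hΔ] with y hy
    rw [hy]
  have hΔm : StronglyMeasurable fun y => F' T y - F T y :=
    (Lp.stronglyMeasurable _).sub (Lp.stronglyMeasurable _)
  have hΔ2 : MemLp (fun y => F' T y - F T y) 2 (domMeasure Y) := (Lp.memLp _).sub (Lp.memLp _)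
  have hquad : ∫ u in U, (∫ y in Y, w (u, y) * (F' T y - F T y)) ^ 2 ≤ Q * τ ^ 2 := by
    refine (memLp_integral_kernel_mul (Lp.stronglyMeasurable w) (Lp.memLp w) hΔm hΔ2).2.trans ?_
    have h1 : ∫ y in Y, (F' T y - F T y) ^ 2 ≤ (L * τ) ^ 2 * V := by
      have h2 := integral_mono_ae hΔ2.integrable_sq (integrable_const ((L * τ) ^ 2))
        (hΔC.mono fun y hy => by
          have := abs_le.1 hy
          exact sq_le_sq' this.1 this.2)
      refine h2.trans (le_of_eq ?_)
      rw [integral_const, smul_eq_mul, mul_comm]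
    calc _ ≤ Wn * ((L * τ) ^ 2 * V) := mul_le_mul_of_nonneg_left h1 hWn0
      _ = Q * τ ^ 2 := by rw [hQ]; ring
  have hquad2 : Q * τ ^ 2 ≤ η / 2 * τ := by
    rw [le_div_iff₀ (by positivity)] at hτ2
    have : Q * τ ≤ η / 2 := by nlinarith
    calc Q * τ ^ 2 = Q * τ * τ := by ring
      _ ≤ _ := mul_le_mul_of_nonneg_right this hτ0.le
  rw [integral_abs_networkOutput_sub_sq w μ P (F T) (F' T), hlin]
  have := (abs_le.1 hv).2
  linarith

/-- Optimality in first-order form. With `qⱼ = σ'(ξⱼ) rⱼ`, every admissible direction `(a', b')`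
satisfies `∑ⱼ ∫ qⱼ (a' - ∫ b' fⱼ) ≥ 0`. -/
theorem IsOptimalControl.sum_integral_nonneg {K : NNReal} (hσL : LipschitzWith K σ)
    (hσ1 : ContDiff ℝ 1 σ) (hT : 0 ≤ T) (ha : BddMeas a) (ha' : BddMeas a') (hb : BddMeas b)
    (hb' : BddMeas b') {A : Set (ℝ × ℝ)} {w : OutputWeightSpace U Y} {μ : StateSpace U}
    {P : Fin N → StateSpace U} {fI : Fin N → StateSpace Y} {F : Fin N → ℝ → StateSpace Y}
    (hopt : IsOptimalControl σ (fun x => x) A w μ P fI c F)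
    {ξ r : Fin N → EuclideanSpace ℝ (Fin d) × ℝ → ℝ}
    (hξ : ∀ j, IsPreactivation (domMeasure Y) T σ a b (fI j) (ξ j))
    (hF : ∀ j, IsTrajectory σ c (fI j) (ξ j) (F j))
    (hr : ∀ j, IsAdjoint (domMeasure Y) T b (fun q => deriv σ (ξ j q))
      (terminalCostate w μ (P j) (F j T)) (r j))
    (hadm : ∀ τ, 0 < τ → τ ≤ 1 →
      ∀ᵐ x ∂(((domMeasure Y).prod (domMeasure Y)).prod (timeMeasure T)),
        (a (x.1.1, x.2) + τ * a' (x.1.1, x.2), b x + τ * b' x) ∈ A) :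
    0 ≤ ∑ j, ∫ p, deriv σ (ξ j p) * r j p *
      controlAction (domMeasure Y) T σ a' b' (fI j) (ξ j) p
        ∂((domMeasure Y).prod (timeMeasure T)) := by
  by_contra! hneg
  -- The derivative `2 * S` is negative; the error `-S / N` per datum uses up half of it.
  set S := ∑ j, ∫ p, deriv σ (ξ j p) * r j p *
      controlAction (domMeasure Y) T σ a' b' (fI j) (ξ j) p
        ∂((domMeasure Y).prod (timeMeasure T)) with hS
  have hN : 0 < N := by
    rcases Nat.eq_zero_or_pos N with rfl | h
    · simp [hS] at hneg
    · exact h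
  have hNr : (0 : ℝ) < N := by exact_mod_cast hN
  have hall : ∀ᶠ τ in nhdsWithin (0 : ℝ) (Ioi 0), ∀ j,
      ∀ (c' : BiasSpace Y T × WeightSpace Y T) ξ' F',
      IsPreactivation (domMeasure Y) T σ (fun p => a p + τ * a' p) (fun x => b x + τ * b' x)
        (fI j) ξ' →
      IsTrajectory σ c' (fI j) ξ' F' →
        ∫ u in U, |networkOutput w μ (F' T) u - P j u| ^ 2 ≤
          (∫ u in U, |networkOutput w μ (F j T) u - P j u| ^ 2) +
            τ * (2 * (∫ p, deriv σ (ξ j p) * r j p *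
              controlAction (domMeasure Y) T σ a' b' (fI j) (ξ j) p
              ∂((domMeasure Y).prod (timeMeasure T))) + -S / N) :=
    Filter.eventually_all.2 fun j => (hξ j).eventually_loss_le hσL hσ1 hT ha' hb hb' (hF j) w μ
      (P j) (hr j) (div_pos (neg_pos.2 hneg) hNr)
  obtain ⟨τ, hτ, hτ01⟩ :=
    (hall.and (Ioc_mem_nhdsGT (zero_lt_one (α := ℝ)))).exists
  have haτ : BddMeas fun p => a p + τ * a' p := ha.add (ha'.const_mul τ)
  have hbτ : BddMeas fun x => b x + τ * b' x := hb.add (hb'.const_mul τ)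
  set c' : BiasSpace Y T × WeightSpace Y T :=
    ((haτ.memLp ∞).toLp _, (hbτ.memLp ∞).toLp _)
  have hc1 : c'.1 =ᵐ[(domMeasure Y).prod (timeMeasure T)] fun p => a p + τ * a' p :=
    (haτ.memLp ∞).coeFn_toLp
  have hc2 : c'.2 =ᵐ[((domMeasure Y).prod (domMeasure Y)).prod (timeMeasure T)]
    fun x => b x + τ * b' x := (hbτ.memLp ∞).coeFn_toLp
  have hc'A : c' ∈ controlSet Y T A := by
    filter_upwards [hadm τ hτ01.1 hτ01.2, ae_weight_of_ae hc1, hc2] with x h1 h2 h3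
    rw [h2, h3]
    exact h1
  choose ξ' hξ' using fun j => exists_isPreactivation (ν := domMeasure Y) (T := T) hσL hT haτ hbτ
    (Lp_measurable (fI j)) (Lp_two_integrable (fI j))
  choose F' hF' hF't using fun j =>
    (hξ' j).exists_isForwardSolution hσL.continuous hbτ hc1 hc2
  have hle := hopt.2.2 c' hc'A F' hF'
  simp only [mseLoss] at hle
  have hle2 := le_of_mul_le_mul_left hle (by positivity)
  have hsum := Finset.sum_le_sum fun j (_ : j ∈ Finset.univ) => hτ j c' (ξ' j) (F' j) (hξ' j) (hF't j)
  rw [Finset.sum_add_distrib, ← Finset.mul_sum, Finset.sum_add_distrib, ← Finset.mul_sum, ← hS,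
    Finset.sum_const, Finset.card_univ, Fintype.card_fin, nsmul_eq_mul, mul_div_cancel₀ _ hNr.ne']
    at hsum
  have : τ * (2 * S + -S) < 0 := mul_neg_of_pos_of_neg hτ01.1 (by linarith)
  linarith

end FirstOrder

/-! ### Interior points of the control sets -/

section Interior

/-- The points whose closed `δ`-ball, in the maximum norm of `ℝ × ℝ`, is contained in `A`. -/
def innerParallel (A : Set (ℝ × ℝ)) (δ : ℝ) : Set (ℝ × ℝ) :=
  {x | ∀ v : ℝ × ℝ, ‖v‖ ≤ δ → x + v ∈ A}

theorem isClosed_innerParallel {A : Set (ℝ × ℝ)} (hA : IsClosed A) (δ : ℝ) :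
    IsClosed (innerParallel A δ) := by
  simp only [innerParallel, Set.ofPred_forall]
  exact isClosed_iInter fun v => isClosed_iInter fun _ =>
    hA.preimage (continuous_id.add continuous_const)

theorem innerParallel_anti (A : Set (ℝ × ℝ)) {δ δ' : ℝ} (h : δ ≤ δ') :
    innerParallel A δ' ⊆ innerParallel A δ := fun _ hx v hv => hx v (hv.trans h)

/-- Countably many constant perturbations detect interior points, since `A` is closed. -/
theorem ae_mem_innerParallel {X : Type*} [MeasurableSpace X] {m : Measure X} {A : Set (ℝ × ℝ)}
    (hA : IsClosed A) {u : X → ℝ × ℝ} {ε : ℝ}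
    (h : ∀ v : ℝ × ℝ, ‖v‖ < ε → ∀ᵐ x ∂m, u x + v ∈ A) {δ : ℝ} (hδ : δ < ε) :
    ∀ᵐ x ∂m, u x ∈ innerParallel A δ := by
  have hcount : ∀ᵐ x ∂m, ∀ n, ‖TopologicalSpace.denseSeq (ℝ × ℝ) n‖ < ε →
      u x + TopologicalSpace.denseSeq (ℝ × ℝ) n ∈ A := by
    refine ae_all_iff.2 fun n => ?_
    by_cases hn : ‖TopologicalSpace.denseSeq (ℝ × ℝ) n‖ < ε
    · filter_upwards [h _ hn] with x hx _ using hx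
    · exact Filter.Eventually.of_forall fun x hx => absurd hx hn
  filter_upwards [hcount] with x hx v hv
  have hcl := (TopologicalSpace.denseRange_denseSeq (ℝ × ℝ)).open_subset_closure_inter
    (Metric.isOpen_ball (x := (0 : ℝ × ℝ)) (ε := ε))
  have hv' : v ∈ closure (Metric.ball (0 : ℝ × ℝ) ε ∩ range (TopologicalSpace.denseSeq (ℝ × ℝ))) :=
    hcl (by simpa using hv.trans_lt hδ)
  have hpre : IsClosed {v | u x + v ∈ A} := hA.preimage (continuous_const.add continuous_id)
  refine closure_minimal ?_ hpre hv'
  rintro _ ⟨hb, n, rfl⟩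
  exact hx n (by simpa using hb)

theorem norm_Lp_top_const_le {X : Type*} [MeasurableSpace X] (m : Measure X) [IsFiniteMeasure m]
    (v : ℝ) : ‖Lp.const ∞ m v‖ ≤ ‖v‖ := by
  simpa using Lp.norm_const_le ∞ m v

variable {d : ℕ} {Y : Set (EuclideanSpace ℝ (Fin d))} [IsFiniteMeasure (domMeasure Y)] {T : ℝ}
  {A : Set (ℝ × ℝ)}

theorem exists_innerParallel_of_mem_interior_localControlSet (hA : IsClosed A)
    {x : ℝ × Lp ℝ ∞ (domMeasure Y)} (hx : x ∈ interior (localControlSet Y A)) :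
    ∃ δ > 0, ∀ᵐ z ∂(domMeasure Y), (x.1, x.2 z) ∈ innerParallel A δ := by
  obtain ⟨ε, hε, hball⟩ := Metric.mem_nhds_iff.1 (mem_interior_iff_mem_nhds.1 hx)
  refine ⟨ε / 2, by positivity, ae_mem_innerParallel hA (fun v hv => ?_) (half_lt_self hε)⟩
  have hmem : (x.1 + v.1, x.2 + Lp.const ∞ (domMeasure Y) v.2) ∈ localControlSet Y A := by
    refine hball ?_
    rw [mem_ball_iff_norm, Prod.norm_def]
    rw [Prod.norm_def] at hv
    have h2 := norm_Lp_top_const_le (domMeasure Y) v.2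
    simpa using ⟨(le_max_left _ _).trans_lt hv, h2.trans_lt ((le_max_right _ _).trans_lt hv)⟩
  filter_upwards [hmem, Lp.coeFn_add x.2 (Lp.const ∞ (domMeasure Y) v.2),
    Lp.coeFn_const ∞ (domMeasure Y) v.2] with z h1 h2 h3
  rw [h2, Pi.add_apply, h3] at h1
  exact h1

theorem exists_innerParallel_of_mem_interior_controlSet (hA : IsClosed A)
    {c : BiasSpace Y T × WeightSpace Y T} (hc : c ∈ interior (controlSet Y T A)) :
    ∃ δ > 0, ∀ᵐ x ∂(((domMeasure Y).prod (domMeasure Y)).prod (timeMeasure T)),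
      (c.1 (x.1.1, x.2), c.2 x) ∈ innerParallel A δ := by
  obtain ⟨ε, hε, hball⟩ := Metric.mem_nhds_iff.1 (mem_interior_iff_mem_nhds.1 hc)
  refine ⟨ε / 2, by positivity, ae_mem_innerParallel hA (fun v hv => ?_) (half_lt_self hε)⟩
  have hmem : (c.1 + Lp.const ∞ _ v.1, c.2 + Lp.const ∞ _ v.2) ∈ controlSet Y T A := by
    refine hball ?_
    rw [mem_ball_iff_norm, Prod.norm_def]
    rw [Prod.norm_def] at hv
    have h1 := norm_Lp_top_const_le ((domMeasure Y).prod (timeMeasure T)) v.1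
    have h2 := norm_Lp_top_const_le (((domMeasure Y).prod (domMeasure Y)).prod (timeMeasure T)) v.2
    simpa using ⟨h1.trans_lt ((le_max_left _ _).trans_lt hv),
      h2.trans_lt ((le_max_right _ _).trans_lt hv)⟩
  filter_upwards [hmem, Lp.coeFn_add c.2 (Lp.const ∞ _ v.2), Lp.coeFn_const ∞ _ v.2,
    ae_weight_of_ae (Lp.coeFn_add c.1 (Lp.const ∞ _ v.1)),
    ae_weight_of_ae (Lp.coeFn_const ∞ ((domMeasure Y).prod (timeMeasure T)) v.1)]
    with x h1 h2 h3 h4 h5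
  rw [h2, h4, Pi.add_apply, Pi.add_apply, h3, h5] at h1
  exact h1

end Interior

/-! ### Weak linear independence -/

/-- The condition of sum zero is the first component of a relation between the vectors
`(1, φⱼ)`. -/
theorem weaklyLinearIndependent_iff_linearIndependent {N : ℕ} {V : Type*} [AddCommGroup V]
    [Module ℝ V] (φ : Fin N → V) :
    WeaklyLinearIndependent φ ↔ LinearIndependent ℝ fun j => ((1 : ℝ), φ j) := by
  rw [Fintype.linearIndependent_iff, WeaklyLinearIndependent]
  simp [Prod.ext_iff, Prod.fst_sum, Prod.snd_sum]

/-- Linear independence of finitely many vectors is an open condition. -/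
theorem exists_forall_weaklyLinearIndependent {N : ℕ} {V : Type*} [NormedAddCommGroup V]
    [NormedSpace ℝ V] {T : ℝ} (hT : 0 < T) {F : Fin N → ℝ → V}
    (hF : ∀ j, ContinuousOn (F j) (Icc 0 T)) (h0 : WeaklyLinearIndependent fun j => F j 0) :
    ∃ ε, 0 < ε ∧ ε ≤ T ∧ ∀ t ∈ Ioo 0 ε, WeaklyLinearIndependent fun j => F j t := by
  have hopen := isOpen_setOfPred_linearIndependent (𝕜 := ℝ) (E := ℝ × V) (ι := Fin N)
  have hcont : ContinuousWithinAt (fun t j => ((1 : ℝ), F j t)) (Icc 0 T) 0 :=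
    continuousWithinAt_pi.2 fun j =>
      continuousWithinAt_const.prodMk (hF j 0 (left_mem_Icc.2 hT.le))
  have hev := hcont.eventually
    (hopen.mem_nhds ((weaklyLinearIndependent_iff_linearIndependent _).1 h0))
  rw [eventually_nhdsWithin_iff, Metric.eventually_nhds_iff] at hev
  obtain ⟨ε, hε, h⟩ := hev
  refine ⟨min ε T, lt_min hε hT, min_le_right _ _, fun t ht => ?_⟩
  refine (weaklyLinearIndependent_iff_linearIndependent _).2
    (h ?_ ⟨ht.1.le, ht.2.le.trans (min_le_right _ _)⟩)
  rw [Real.dist_eq, sub_zero, abs_of_pos ht.1]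
  exact ht.2.trans_le (min_le_left _ _)

/-! ### Localization of the first-order condition -/

/-- Truncation of a real number to `[-1, 1]`. -/
noncomputable def clip (x : ℝ) : ℝ := max (-1) (min 1 x)

theorem continuous_clip : Continuous clip := by
  unfold clip; fun_prop

theorem abs_clip_le (x : ℝ) : |clip x| ≤ 1 :=
  abs_le.2 ⟨le_max_left _ _, max_le (by norm_num) (min_le_left _ _)⟩

theorem mul_clip_pos {x : ℝ} (hx : x ≠ 0) : 0 < x * clip x := by
  rcases lt_or_gt_of_ne hx with h | h
  · refine mul_pos_of_neg_of_neg h (max_lt (by norm_num) (min_lt_of_right_lt h))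
  · exact mul_pos h (lt_max_of_lt_right (lt_min one_pos h))

theorem mul_clip_nonneg (x : ℝ) : 0 ≤ x * clip x := by
  rcases eq_or_ne x 0 with rfl | h
  · simp
  · exact (mul_clip_pos h).le

theorem eq_zero_of_mul_clip_eq_zero {x : ℝ} (h : x * clip x = 0) : x = 0 := by
  by_contra hx
  exact (mul_clip_pos hx).ne' h

section Localization

variable {l d N : ℕ} {U : Set (EuclideanSpace ℝ (Fin l))} {Y : Set (EuclideanSpace ℝ (Fin d))}
  [IsFiniteMeasure (domMeasure Y)] {T : ℝ} {σ : ℝ → ℝ} {c : BiasSpace Y T × WeightSpace Y T}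
  {a : EuclideanSpace ℝ (Fin d) × ℝ → ℝ}
  {b : (EuclideanSpace ℝ (Fin d) × EuclideanSpace ℝ (Fin d)) × ℝ → ℝ}

/-- Where the control stays at distance `δ` from the boundary of `A`, both moments
`∑ⱼ qⱼ` and `∑ⱼ qⱼ fⱼ` of `qⱼ = σ'(ξⱼ) rⱼ` vanish: the truncated moments are an admissible
direction of descent. -/
theorem IsOptimalControl.moments_eq_zero {K : NNReal} (hσL : LipschitzWith K σ)
    (hσ1 : ContDiff ℝ 1 σ) (hT : 0 ≤ T) (ha : BddMeas a) (hb : BddMeas b)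
    (hca : c.1 =ᵐ[(domMeasure Y).prod (timeMeasure T)] a)
    (hcb : c.2 =ᵐ[((domMeasure Y).prod (domMeasure Y)).prod (timeMeasure T)] b)
    {A : Set (ℝ × ℝ)} (hA : IsClosed A) {w : OutputWeightSpace U Y} {μ : StateSpace U}
    {P : Fin N → StateSpace U} {fI : Fin N → StateSpace Y} {F : Fin N → ℝ → StateSpace Y}
    (hopt : IsOptimalControl σ (fun x => x) A w μ P fI c F)
    {ξ r : Fin N → EuclideanSpace ℝ (Fin d) × ℝ → ℝ}
    (hξ : ∀ j, IsPreactivation (domMeasure Y) T σ a b (fI j) (ξ j))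
    (hF : ∀ j, IsTrajectory σ c (fI j) (ξ j) (F j))
    (hr : ∀ j, IsAdjoint (domMeasure Y) T b (fun q => deriv σ (ξ j q))
      (terminalCostate w μ (P j) (F j T)) (r j)) {δ : ℝ} (hδ : 0 < δ) :
    ∀ᵐ p ∂((domMeasure Y).prod (timeMeasure T)),
      (∀ᵐ z ∂(domMeasure Y), (a p, b ((p.1, z), p.2)) ∈ innerParallel A δ) →
        (∑ j, deriv σ (ξ j p) * r j p = 0) ∧ ∀ᵐ z ∂(domMeasure Y),
          ∑ j, deriv σ (ξ j p) * r j p * stateOf T σ (fI j) (ξ j) (z, p.2) = 0 := by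
  classical
  have hσ := hσL.continuous
  have hκ : ∀ j, BddMeas fun q => deriv σ (ξ j q) := fun j =>
    (hξ j).bddMeas.continuous_comp (hσ1.continuous_deriv le_rfl)
  have hρm : ∀ j, Measurable (terminalCostate w μ (P j) (F j T)) := fun j =>
    (stronglyMeasurable_terminalCostate w μ (P j) (F j T)).measurable
  have hρi : ∀ j, Integrable (terminalCostate w μ (P j) (F j T)) (domMeasure Y) := fun j =>
    (memLp_terminalCostate w μ (P j) (F j T)).integrable one_le_two
  set q : Fin N → EuclideanSpace ℝ (Fin d) × ℝ → ℝ := fun j p => deriv σ (ξ j p) * r j p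
  have hqm : ∀ j, Measurable (q j) := fun j => (hκ j).meas.mul ((hr j).measurable (hρm j))
  have hqi : ∀ j, Integrable (q j) ((domMeasure Y).prod (timeMeasure T)) := fun j =>
    (hκ j).mul_integrable ((hr j).integrable (hρi j))
  have hP : ∀ j, BddMeas (pastIntegral T fun q => σ (ξ j q)) := fun j =>
    ((hξ j).bddMeas.continuous_comp hσ).pastIntegral
  have hfm : ∀ j, Measurable (stateOf T σ (fI j) (ξ j)) := fun j =>
    ((Lp_measurable (fI j)).comp measurable_fst).add (hP j).meas
  have hfi : ∀ j s, Integrable (fun z => stateOf T σ (fI j) (ξ j) (z, s)) (domMeasure Y) :=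
    fun j s => (Lp_two_integrable (fI j)).add ((hP j).comp measurable_prodMk_right).integrable
  -- The two moments, with `H` at the triple `((y, z), t)`.
  set G : EuclideanSpace ℝ (Fin d) × ℝ → ℝ := fun p => ∑ j, q j p with hG
  set H : (EuclideanSpace ℝ (Fin d) × EuclideanSpace ℝ (Fin d)) × ℝ → ℝ := fun x =>
    ∑ j, q j (x.1.1, x.2) * stateOf T σ (fI j) (ξ j) (x.1.2, x.2) with hH
  have hGm : Measurable G := Finset.measurable_sum _ fun j _ => hqm j
  have hHm : Measurable H := Finset.measurable_sum _ fun j _ =>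
    ((hqm j).comp (by fun_prop)).mul ((hfm j).comp (by fun_prop))
  -- The set where the closed `δ`-ball around the control is contained in `A`.
  set good : EuclideanSpace ℝ (Fin d) × ℝ → Prop := fun p =>
    ∀ᵐ z ∂(domMeasure Y), (a p, b ((p.1, z), p.2)) ∈ innerParallel A δ
  have hinner : MeasurableSet (innerParallel A δ) := (isClosed_innerParallel hA δ).measurableSet
  have hgood : MeasurableSet {p | good p} := by
    have hs : MeasurableSet {x : (EuclideanSpace ℝ (Fin d) × ℝ) × EuclideanSpace ℝ (Fin d) |
        (a x.1, b ((x.1.1, x.2), x.1.2)) ∉ innerParallel A δ} := by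
      refine (MeasurableSet.preimage hinner ?_).compl
      exact (ha.meas.comp measurable_fst).prodMk (hb.meas.comp (by fun_prop))
    exact (measurable_measure_prodMk_left (ν := domMeasure Y) hs) (measurableSet_singleton 0)
  have hgood3 : MeasurableSet {x : (EuclideanSpace ℝ (Fin d) × EuclideanSpace ℝ (Fin d)) × ℝ |
      good (x.1.1, x.2)} :=
    hgood.preimage (f := fun x : (EuclideanSpace ℝ (Fin d) × EuclideanSpace ℝ (Fin d)) × ℝ =>
      (x.1.1, x.2)) (by fun_prop)
  have hclip : ∀ {X : Type} [MeasurableSpace X] {u : X → ℝ}, Measurable u →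
      BddMeas fun x => clip (u x) := fun hu =>
    ⟨continuous_clip.measurable.comp hu, 1, fun x => abs_clip_le _⟩
  have ha' : BddMeas fun p => if good p then -δ * clip (G p) else 0 :=
    BddMeas.ite hgood ((hclip hGm).const_mul (-δ)) (BddMeas.const 0)
  have hb' : BddMeas fun x => if good (x.1.1, x.2) then δ * clip (H x) else 0 :=
    BddMeas.ite hgood3 ((hclip hHm).const_mul δ) (BddMeas.const 0)
  have hadm : ∀ τ, 0 < τ → τ ≤ 1 →
      ∀ᵐ x ∂(((domMeasure Y).prod (domMeasure Y)).prod (timeMeasure T)),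
        (a (x.1.1, x.2) + τ * (if good (x.1.1, x.2) then -δ * clip (G (x.1.1, x.2)) else 0),
          b x + τ * (if good (x.1.1, x.2) then δ * clip (H x) else 0)) ∈ A := by
    intro τ hτ0 hτ1
    have h1 : ∀ᵐ x ∂(((domMeasure Y).prod (domMeasure Y)).prod (timeMeasure T)),
        good (x.1.1, x.2) → (a (x.1.1, x.2), b x) ∈ innerParallel A δ := by
      refine ae_weight_of_ae_ae ?_ (Filter.Eventually.of_forall fun p => ?_)
      · have hm : MeasurableSet {x : (EuclideanSpace ℝ (Fin d) × EuclideanSpace ℝ (Fin d)) × ℝ |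
            (a (x.1.1, x.2), b x) ∈ innerParallel A δ} :=
          MeasurableSet.preimage hinner ((ha.meas.comp (by fun_prop)).prodMk hb.meas)
        exact hgood3.imp hm
      · by_cases hp : good p
        · filter_upwards [hp] with z hz _ using hz
        · exact Filter.Eventually.of_forall fun z h => absurd h hp
    filter_upwards [h1, hopt.1, ae_weight_of_ae hca, hcb] with x k1 k2 k3 k4
    by_cases hx : good (x.1.1, x.2)
    · simp only [hx, if_true]
      have hle : ∀ u, |τ * (δ * clip u)| ≤ δ := fun u => by
        rw [abs_mul, abs_mul, abs_of_pos hτ0, abs_of_pos hδ]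
        have := abs_clip_le u
        calc τ * (δ * |clip u|) ≤ 1 * (δ * 1) := by gcongr
          _ = δ := by ring
      have := k1 hx (τ * (-δ * clip (G (x.1.1, x.2))), τ * (δ * clip (H x))) (by
        rw [Prod.norm_def]
        refine max_le ?_ (hle _)
        rw [Real.norm_eq_abs, neg_mul, mul_neg, abs_neg]
        exact hle _)
      exact this
    · rw [k3, k4] at k2
      simpa [hx] using k2
  have hsum := hopt.sum_integral_nonneg hσL hσ1 hT ha ha' hb hb' hξ hF hr hadm
  set v : Fin N → EuclideanSpace ℝ (Fin d) × ℝ → ℝ := fun j =>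
    controlAction (domMeasure Y) T σ (fun p => if good p then -δ * clip (G p) else 0)
      (fun x => if good (x.1.1, x.2) then δ * clip (H x) else 0) (fI j) (ξ j) with hv
  have hvb : ∀ j, BddMeas (v j) := fun j =>
    BddMeas.controlAction hσ ha' hb' (Lp_measurable (fI j)) (Lp_two_integrable (fI j))
      (hξ j).bddMeas
  have hqv : ∀ j, Integrable (fun p => q j p * v j p) ((domMeasure Y).prod (timeMeasure T)) :=
    fun j => by simpa only [mul_comm] using (hvb j).mul_integrable (hqi j)
  have hsum' : 0 ≤ ∫ p, ∑ j, q j p * v j p ∂((domMeasure Y).prod (timeMeasure T)) := by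
    rw [integral_finsetSum _ fun j _ => hqv j]
    exact hsum
  have hHi : ∀ p : EuclideanSpace ℝ (Fin d) × ℝ,
      Integrable (fun z => H ((p.1, z), p.2) * clip (H ((p.1, z), p.2))) (domMeasure Y) := by
    intro p
    have h1 : Integrable (fun z => H ((p.1, z), p.2)) (domMeasure Y) :=
      integrable_finsetSum _ fun j _ => (hfi j p.2).const_mul (q j p)
    simpa only [mul_comm] using
      ((hclip hHm).comp (e := fun z => ((p.1, z), p.2)) (by fun_prop)).mul_integrable h1
  have hval : ∀ p, good p → ∑ j, q j p * v j p = -δ * (G p * clip (G p) +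
      ∫ z in Y, H ((p.1, z), p.2) * clip (H ((p.1, z), p.2))) := by
    intro p hp
    have hbp : BddMeas fun z => δ * clip (H ((p.1, z), p.2)) :=
      ((hclip hHm).comp (e := fun z => ((p.1, z), p.2)) (by fun_prop)).const_mul δ
    have e1 : ∀ j, q j p * v j p = q j p * (-δ * clip (G p)) -
        ∫ z in Y, q j p * (δ * clip (H ((p.1, z), p.2)) *
          stateOf T σ (fI j) (ξ j) (z, p.2)) := by
      intro j
      rw [integral_const_mul, ← mul_sub]
      simp only [hv, controlAction, hp, if_true]
    rw [Finset.sum_congr rfl fun j _ => e1 j, Finset.sum_sub_distrib, ← Finset.sum_mul,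
      ← integral_finsetSum _ fun j _ => (hbp.mul_integrable (hfi j p.2)).const_mul (q j p)]
    have e2 : ∫ z in Y, ∑ j, q j p * (δ * clip (H ((p.1, z), p.2)) *
          stateOf T σ (fI j) (ξ j) (z, p.2)) =
        δ * ∫ z in Y, H ((p.1, z), p.2) * clip (H ((p.1, z), p.2)) := by
      rw [← integral_const_mul]
      refine integral_congr_ae (Filter.Eventually.of_forall fun z => ?_)
      dsimp only
      conv_rhs => rw [hH]
      dsimp only
      rw [Finset.sum_mul, Finset.mul_sum]
      exact Finset.sum_congr rfl fun j _ => by ring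
    rw [e2, hG]
    ring
  have hval0 : ∀ p, ¬ good p → ∑ j, q j p * v j p = 0 := by
    intro p hp
    refine Finset.sum_eq_zero fun j _ => ?_
    simp [hv, controlAction, hp]
  have hint0 : ∀ p : EuclideanSpace ℝ (Fin d) × ℝ, 0 ≤ ∫ z in Y, H ((p.1, z), p.2) * clip (H ((p.1, z), p.2)) := fun p =>
    integral_nonneg fun z => mul_clip_nonneg _
  have hnonpos : ∀ p, ∑ j, q j p * v j p ≤ 0 := by
    intro p
    by_cases hp : good p
    · rw [hval p hp]
      have := mul_nonneg hδ.le (add_nonneg (mul_clip_nonneg (G p)) (hint0 p))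
      linarith
    · exact (hval0 p hp).le
  have hzero : ∀ᵐ p ∂((domMeasure Y).prod (timeMeasure T)), ∑ j, q j p * v j p = 0 := by
    have hi : Integrable (fun p => -∑ j, q j p * v j p) ((domMeasure Y).prod (timeMeasure T)) :=
      (integrable_finsetSum _ fun j _ => hqv j).neg
    have h0 : ∫ p, -∑ j, q j p * v j p ∂((domMeasure Y).prod (timeMeasure T)) = 0 := by
      refine le_antisymm ?_ (integral_nonneg fun p => neg_nonneg.2 (hnonpos p))
      rw [integral_neg]
      linarith
    filter_upwards [(integral_eq_zero_iff_of_nonneg (fun p => neg_nonneg.2 (hnonpos p)) hi).1 h0]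
      with p hp
    exact neg_eq_zero.1 hp
  filter_upwards [hzero] with p hp hgp
  rw [hval p hgp] at hp
  have hp' := (mul_eq_zero.1 hp).resolve_left (neg_ne_zero.2 hδ.ne')
  have hG0 : G p * clip (G p) = 0 := by
    linarith [mul_clip_nonneg (G p), hint0 p]
  have hH0 : ∫ z in Y, H ((p.1, z), p.2) * clip (H ((p.1, z), p.2)) = 0 := by linarith
  refine ⟨eq_zero_of_mul_clip_eq_zero hG0, ?_⟩
  filter_upwards [(integral_eq_zero_iff_of_nonneg (fun z => mul_clip_nonneg _) (hHi p)).1 hH0]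
    with z hz
  exact eq_zero_of_mul_clip_eq_zero hz

end Localization

/-! ### Boundary controls and least-squares solutions -/

theorem mainTheorem8 {d l N : ℕ}
    (Y : Set (EuclideanSpace ℝ (Fin d))) (hY : IsOpen Y) (hYb : Bornology.IsBounded Y)
    (U : Set (EuclideanSpace ℝ (Fin l))) (hU : IsOpen U) (hUb : Bornology.IsBounded U)
    (T : ℝ) (hT : 0 < T)
    (σ : ℝ → ℝ) (hσL : ∃ K, LipschitzWith K σ) (hσ1 : ContDiff ℝ 1 σ)
    (hσ' : ∀ x, 0 < deriv σ x)
    (A : Set (ℝ × ℝ)) (hAb : Bornology.IsBounded A) (hAconv : Convex ℝ A) (hAcl : IsClosed A)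
    (hAint : (interior A).Nonempty)
    (w : OutputWeightSpace U Y) (μ : StateSpace U) (P : Fin N → StateSpace U)
    (fI : Fin N → StateSpace Y) (hfI : WeaklyLinearIndependent fI)
    (c : BiasSpace Y T × WeightSpace Y T) (F : Fin N → ℝ → StateSpace Y)
    (hopt : IsOptimalControl σ (fun ξ => ξ) A w μ P fI c F) :
    ((c ∈ interior (controlSet Y T A) ∧
        ∀ j, IsLeastSquaresSolution w μ (P j) (F j T)) ∨
      c ∈ frontier (controlSet Y T A)) ∧
    ∃ r : Fin N → ℝ → StateSpace Y,
      (∀ j, IsCostate σ (fun ξ => ξ) w μ (P j) c (F j) (r j)) ∧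
      ∃ ε : ℝ, 0 < ε ∧ ε ≤ T ∧
        ∀ᵐ t ∂(volume.restrict (Ioo 0 ε)), ∀ᵐ y ∂(domMeasure Y),
          (∃ j, r j t y ≠ 0) →
            ∃ hb : MemLp (fun z => c.2 ((y, z), t)) ∞ (domMeasure Y),
              (c.1 (y, t), hb.toLp (fun z => c.2 ((y, z), t))) ∈
                frontier (localControlSet Y A) := by
  have : IsFiniteMeasure (domMeasure Y) :=
    ⟨by simpa [domMeasure] using hYb.measure_lt_top⟩
  obtain ⟨K, hσL⟩ := hσL
  have hσd : Continuous (deriv σ) := hσ1.continuous_deriv le_rfl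
  obtain ⟨a, ha, hca⟩ := exists_bddMeas_rep c.1
  obtain ⟨b, hb, hcb⟩ := exists_bddMeas_rep c.2
  choose ξ hξ hF using fun j =>
    (hopt.2.1 j).exists_isPreactivation hT.le hσL.continuous ha hb hca hcb
  have hκ : ∀ j, BddMeas fun q => deriv σ (ξ j q) := fun j =>
    (hξ j).bddMeas.continuous_comp hσd
  have hρm : ∀ j, Measurable (terminalCostate w μ (P j) (F j T)) := fun j =>
    (stronglyMeasurable_terminalCostate w μ (P j) (F j T)).measurable
  have hρi : ∀ j, Integrable (terminalCostate w μ (P j) (F j T)) (domMeasure Y) := fun j =>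
    (memLp_terminalCostate w μ (P j) (F j T)).integrable one_le_two
  choose r hr using fun j => exists_isAdjoint (T := T) hT.le (hκ j) hb (hρm j) (hρi j)
  choose R hRc hRr using fun j =>
    (hF j).exists_isCostate hT.le hσd hb hcb w μ (P j) (hξ j).bddMeas (hr j)
  have hF0 : ∀ j, F j 0 = fI j := fun j => by
    refine Lp.ext ?_
    filter_upwards [(hopt.2.1 j).2 0 (left_mem_Icc.2 hT.le)] with y hy
    rw [hy, intervalIntegral.integral_same, add_zero]
  obtain ⟨ε, hε, hεT, hind⟩ := exists_forall_weaklyLinearIndependent hT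
    (fun j => (hopt.2.1 j).1) (by simpa only [hF0] using hfI)
  -- For small times the co-states vanish wherever the control is interior.
  have hkey : ∀ᵐ p ∂((domMeasure Y).prod (timeMeasure T)), p.2 < ε → ∀ δ > 0,
      (∀ᵐ z ∂(domMeasure Y), (c.1 p, c.2 ((p.1, z), p.2)) ∈ innerParallel A δ) →
        ∀ j, r j p = 0 := by
    have hmom := ae_all_iff.2 fun n : ℕ => hopt.moments_eq_zero hσL hσ1 hT.le ha hb hca hcb hAcl
      hξ hF hr (δ := 1 / ((n : ℝ) + 1)) (by positivity)
    filter_upwards [hmom, ae_time_mem (domMeasure Y) T, hca, ae_ae_of_ae_weight hcb]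
      with p h1 h2 h3 h4 hpε δ hδ hin j
    obtain ⟨n, hn⟩ := exists_nat_one_div_lt hδ
    obtain ⟨k1, k2⟩ := h1 n (by
      filter_upwards [hin, h4] with z m1 m2
      rw [h3, m2] at m1
      exact innerParallel_anti A hn.le m1)
    have hlin : ∑ j, (deriv σ (ξ j p) * r j p) • F j p.2 = 0 := by
      refine Lp.ext ?_
      have hst : ∀ᵐ z ∂(domMeasure Y), ∀ j, F j p.2 z = stateOf T σ (fI j) (ξ j) (z, p.2) :=
        ae_all_iff.2 fun j => (hF j).state p.2 (Ioo_subset_Icc_self h2)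
      have hsm : ∀ᵐ z ∂(domMeasure Y), ∀ j, ((deriv σ (ξ j p) * r j p) • F j p.2 : StateSpace Y) z =
          (deriv σ (ξ j p) * r j p) * F j p.2 z :=
        ae_all_iff.2 fun j => Lp.coeFn_smul _ _
      filter_upwards [Lp.coeFn_finsetSum Finset.univ fun j =>
        (deriv σ (ξ j p) * r j p) • F j p.2, hst, hsm, k2, Lp.coeFn_zero ℝ 2 (domMeasure Y)]
        with z m1 m2 m3 m4 m5
      rw [m1, m5, Pi.zero_apply, ← m4, Finset.sum_apply]
      exact Finset.sum_congr rfl fun j _ => by rw [m3, m2]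
    exact (mul_eq_zero.1 (hind p.2 ⟨h2.1, hpε⟩ _ k1 hlin j)).resolve_left (hσ' _).ne'
  refine ⟨?_, R, hRc, ε, hε, hεT, ?_⟩
  · by_cases hint : c ∈ interior (controlSet Y T A)
    · refine Or.inl ⟨hint, fun j => isLeastSquaresSolution_of_terminalCostate_eq_zero w μ (P j)
        (F j T) ?_⟩
      obtain ⟨δ, hδ, hin⟩ := exists_innerParallel_of_mem_interior_controlSet hAcl hint
      refine (hr j).terminal_eq_zero_of_initial_eq_zero hT (hκ j) hb (hρm j) (hρi j) hε hεT ?_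
      filter_upwards [hkey, ae_ae_of_ae_weight hin] with p h1 h2 hpε
      exact h1 hpε δ hδ h2 j
    · exact Or.inr ⟨subset_closure hopt.1, hint⟩
  · have hall : ∀ᵐ p ∂((domMeasure Y).prod (timeMeasure T)), p.2 < ε →
        (∃ j, r j p ≠ 0) → ∃ hb : MemLp (fun z => c.2 ((p.1, z), p.2)) ∞ (domMeasure Y),
          (c.1 p, hb.toLp (fun z => c.2 ((p.1, z), p.2))) ∈ frontier (localControlSet Y A) := by
      filter_upwards [hkey, ae_ae_of_ae_weight hcb, ae_ae_of_ae_weight hopt.1]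
        with p h1 h2 h3 hpε hex
      have hbp : BddMeas fun z => b ((p.1, z), p.2) := hb.comp (by fun_prop)
      have hmem : MemLp (fun z => c.2 ((p.1, z), p.2)) ∞ (domMeasure Y) :=
        (memLp_congr_ae h2).2 (hbp.memLp ∞)
      refine ⟨hmem, subset_closure ?_, fun hint => ?_⟩
      · filter_upwards [h3, hmem.coeFn_toLp] with z m1 m2
        rw [m2]
        exact m1
      · obtain ⟨δ, hδ, hin⟩ := exists_innerParallel_of_mem_interior_localControlSet hAcl hint
        obtain ⟨j, hj⟩ := hex
        refine hj (h1 hpε δ hδ ?_ j)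
        filter_upwards [hin, hmem.coeFn_toLp] with z m1 m2
        rw [m2] at m1
        exact m1
    filter_upwards [ae_restrict_mem measurableSet_Ioo, ae_restrict_of_ae_restrict_of_subset
      (Ioo_subset_Ioo_right hεT) (ae_ae_time hall)] with t ht h1
    have h2 : ∀ᵐ y ∂(domMeasure Y), ∀ j, R j t y = r j (y, t) :=
      ae_all_iff.2 fun j => hRr j t ⟨ht.1.le, ht.2.le.trans hεT⟩
    filter_upwards [h1, h2] with y k1 k2 hex
    refine k1 ht.2 ?_
    obtain ⟨j, hj⟩ := hex
    exact ⟨j, by rwa [← k2 j]⟩
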